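/- Let $d\ge 3$ and let $\Delta$ be the discrete Laplacian on $\ell^2(\mathbb Z^d)$, $(\Delta f)(n)=\frac12\sum_{j=1}^d\bigl(f(n+e_j)+f(n-e_j)\bigr)$. Let $V\colon\mathbb Z^d\to\mathbb R$ belong to $\ell^p(\mathbb Z^d)$, where $1\le p<\frac65$ if $d=3$ and $1\le p<\frac{3d}{2d+1}$ if $d\ge4$, and let $H=\Delta+V$. Put $q_1=|V|^{1/2}$ and let $q_2\in\ell^{2p}(\mathbb Z^d)$ be any (complex) sequence with $V=q_1q_2$. For $\operatorname{Im}z>0$ write $R_0(z)=(\Delta-z)^{-1}$. Then for every $\lambda\in\mathbb R$ the limit $$q_1R_0(\lambda+i0)q_2:=\lim_{z\to\lambda,\ \operatorname{Im}z>0}q_1R_0(z)q_2$$ exists in operator norm, and the Birman–Schwinger spectrum $$\sigma_{\rm BS}(H)=\bigl\{\lambda\in\mathbb R\ :\ f=-q_1R_0(\lambda+i0)q_2f\ \text{ for some non-zero } f\in\ell^2(\mathbb Z^d)\bigr\}$$ is a compact subset of the spectrum $\sigma(H)$ with zero Lebesgue measure. -/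

import Mathlib

open Filter Topology MeasureTheory
open scoped ENNReal

noncomputable section

namespace LatticeSchrodinger

/-- The lattice `ℤ^d`. -/
abbrev Lattice (d : ℕ) : Type := Fin d → ℤ

/-- The complex Hilbert space `ℓ²(ℤ^d)`. -/
abbrev L2 (d : ℕ) : Type := lp (fun _ : Lattice d => ℂ) 2

theorem memlp_translate {d : ℕ} (a : Lattice d) (f : L2 d) :
    Memℓp (fun n : Lattice d => f (n + a)) 2 := by
  have h2 : (0 : ℝ) < (2 : ℝ≥0∞).toReal := by norm_num
  exact memℓp_gen (((lp.memℓp f).summable h2).comp_injective (add_left_injective a))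

/-- Translation on `ℓ²(ℤ^d)`: `(translate a f)(n) = f (n + a)`. -/
def translate {d : ℕ} (a : Lattice d) : L2 d →L[ℂ] L2 d :=
  LinearIsometry.toContinuousLinearMap
    { toFun := fun f => ⟨fun n => f (n + a), memlp_translate a f⟩
      map_add' := fun _ _ => rfl
      map_smul' := fun _ _ => rfl
      norm_map' := fun f => by
        have h2 : (0 : ℝ) < (2 : ℝ≥0∞).toReal := by norm_num
        rw [lp.norm_eq_tsum_rpow h2, lp.norm_eq_tsum_rpow h2 f]
        congr 1
        exact (Equiv.addRight a).tsum_eq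
          (fun n : Lattice d => ‖f n‖ ^ (2 : ℝ≥0∞).toReal) }

theorem translate_apply {d : ℕ} (a : Lattice d) (f : L2 d) (n : Lattice d) :
    translate a f n = f (n + a) := rfl

/-- The discrete Laplacian `(Δ f)(n) = (1/2) ∑_j (f (n + e_j) + f (n - e_j))` on `ℓ²(ℤ^d)`. -/
def discreteLaplacian (d : ℕ) : L2 d →L[ℂ] L2 d :=
  (1 / 2 : ℂ) • ∑ j : Fin d,
    (translate (Pi.single j 1 : Lattice d) + translate (-(Pi.single j 1) : Lattice d))

open Classical in
/-- The operator of multiplication by a bounded sequence `u` on `ℓ²(ℤ^d)`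
(with the default value `0` if `u` is unbounded). -/
def mulOp {d : ℕ} (u : Lattice d → ℂ) : L2 d →L[ℂ] L2 d :=
  if hu : Memℓp u ∞ then
    lp.holderL (p := ∞) (q := 2) 2 (fun _ : Lattice d => ContinuousLinearMap.mul ℂ ℂ) (K := 1)
      (fun _ => ContinuousLinearMap.opNorm_mul_le ℂ ℂ) ⟨u, hu⟩
  else 0

theorem mulOp_apply {d : ℕ} {u : Lattice d → ℂ} (hu : Memℓp u ∞) (f : L2 d) (n : Lattice d) :
    mulOp u f n = u n * f n := by
  rw [mulOp, dif_pos hu]; rfl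

/-- The Schrödinger operator `H = Δ + V` on `ℓ²(ℤ^d)`. -/
def hamiltonian {d : ℕ} (V : Lattice d → ℝ) : L2 d →L[ℂ] L2 d :=
  discreteLaplacian d + mulOp (fun n => (V n : ℂ))

/-- The free resolvent `R₀(z) = (Δ - z)⁻¹`. -/
def freeResolvent (d : ℕ) (z : ℂ) : L2 d →L[ℂ] L2 d :=
  Ring.inverse (discreteLaplacian d - algebraMap ℂ (L2 d →L[ℂ] L2 d) z)

/-- The sequence `q₁ = |V|^{1/2}`. -/
def sqrtAbs {d : ℕ} (V : Lattice d → ℝ) : Lattice d → ℂ :=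
  fun n => (Real.sqrt |V n| : ℂ)

/-- The sandwiched free resolvent `Y₀(z) = q₁ R₀(z) q₂`, with `q₁ = |V|^{1/2}`. -/
def sandwichedResolvent {d : ℕ} (V : Lattice d → ℝ) (q₂ : Lattice d → ℂ) (z : ℂ) :
    L2 d →L[ℂ] L2 d :=
  mulOp (sqrtAbs V) ∘L freeResolvent d z ∘L mulOp q₂

/-- The boundary value `q₁ R₀(x + i0) q₂` at a real point `x`: the limit in operator norm of
`q₁ R₀(z) q₂` as `z → x` in the open upper half-plane. -/
def boundaryResolvent {d : ℕ} (V : Lattice d → ℝ) (q₂ : Lattice d → ℂ) (x : ℝ) :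
    L2 d →L[ℂ] L2 d :=
  limUnder (𝓝[{z : ℂ | 0 < z.im}] (x : ℂ)) (sandwichedResolvent V q₂)

/-- The Birman–Schwinger spectrum: the set of real `x` for which the equation
`f = - q₁ R₀(x + i0) q₂ f` has a non-zero solution `f ∈ ℓ²(ℤ^d)`. -/
def birmanSchwingerSpectrum {d : ℕ} (V : Lattice d → ℝ) (q₂ : Lattice d → ℂ) : Set ℝ :=
  {x : ℝ | ∃ f : L2 d, f ≠ 0 ∧ f = -(boundaryResolvent V q₂ x f)}

end LatticeSchrodinger

end

noncomputable section

namespace LatticeSchrodinger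

section VanDerCorput

open Set Real

variable {f f' f'' : ℝ → ℝ} {a b : ℝ}

theorem norm_exp_I_mul_ofReal (x : ℝ) : ‖Complex.exp (Complex.I * x)‖ = 1 := by
  rw [mul_comm]; exact Complex.norm_exp_ofReal_mul_I x

/-- The first derivative test for oscillatory integrals. -/
theorem norm_integral_exp_le_of_deriv_ge (hab : a ≤ b) (hf : ∀ x, HasDerivAt f (f' x) x)
    (hf' : ∀ x, HasDerivAt f' (f'' x) x) (hc : Continuous f'')
    (hmono : ∀ x ∈ Icc a b, 0 ≤ f'' x) {l : ℝ} (hl : 0 < l)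
    (h : (∀ x ∈ Icc a b, l ≤ f' x) ∨ (∀ x ∈ Icc a b, f' x ≤ -l)) :
    ‖∫ x in a..b, Complex.exp (Complex.I * f x)‖ ≤ 4 / l := by
  have hcf' : Continuous f' := continuous_iff_continuousAt.2 fun x => (hf' x).continuousAt
  have hcf : Continuous f := continuous_iff_continuousAt.2 fun x => (hf x).continuousAt
  have habs : ∀ x ∈ Icc a b, l ≤ |f' x| := by
    rcases h with h | h
    · intro x hx; exact (h x hx).trans (le_abs_self _)
    · intro x hx; have := h x hx; exact (by linarith : l ≤ -f' x).trans (neg_le_abs _)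
  have hne : ∀ x ∈ Icc a b, f' x ≠ 0 := fun x hx h0 => by
    have := habs x hx; rw [h0, abs_zero] at this; linarith
  have hinv : ∀ x ∈ Icc a b, |(f' x)⁻¹| ≤ 1 / l := fun x hx => by
    rw [abs_inv, one_div]; exact inv_anti₀ hl (habs x hx)
  have hui : uIcc a b = Icc a b := uIcc_of_le hab
  have hgderiv : ∀ x ∈ Icc a b, HasDerivAt (fun x => (f' x)⁻¹) (-(f'' x) / (f' x) ^ 2) x :=
    fun x hx => (hf' x).inv (hne x hx)
  have hgcont : ContinuousOn (fun x => -(f'' x) / (f' x) ^ 2) (Icc a b) := by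
    apply ContinuousOn.div (by fun_prop) (by fun_prop)
    intro x hx; exact pow_ne_zero 2 (hne x hx)
  have hftc : ∫ x in a..b, -(f'' x) / (f' x) ^ 2 = (f' b)⁻¹ - (f' a)⁻¹ :=
    intervalIntegral.integral_eq_sub_of_hasDerivAt (fun x hx => hgderiv x (hui ▸ hx))
      (ContinuousOn.intervalIntegrable (hui ▸ hgcont))
  have hparts := intervalIntegral.integral_mul_deriv_eq_deriv_mul
    (a := a) (b := b)
    (u := fun x => ((f' x)⁻¹ : ℂ)) (v := fun x => -Complex.I * Complex.exp (Complex.I * f x))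
    (u' := fun x => ((-(f'' x) / (f' x) ^ 2 : ℝ) : ℂ))
    (v' := fun x => (f' x : ℂ) * Complex.exp (Complex.I * f x))
    (fun x hx => by
      have := (hgderiv x (hui ▸ hx)).ofReal_comp
      simpa using this)
    (fun x hx => by
      have := (((hf x).ofReal_comp).const_mul Complex.I).cexp.const_mul (-Complex.I)
      convert this using 1
      linear_combination ((f' x : ℂ) * Complex.exp (Complex.I * f x)) * Complex.I_mul_I)
    (ContinuousOn.intervalIntegrable (hui ▸ Complex.continuous_ofReal.comp_continuousOn hgcont))
    (Continuous.intervalIntegrable (by fun_prop) _ _)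
  have hI : ∫ x in a..b, Complex.exp (Complex.I * f x)
      = ∫ x in a..b, ((f' x)⁻¹ : ℂ) * ((f' x : ℂ) * Complex.exp (Complex.I * f x)) := by
    apply intervalIntegral.integral_congr
    intro x hx
    have : (f' x : ℂ) ≠ 0 := by exact_mod_cast hne x (hui ▸ hx)
    simp only
    field_simp
  have hnorm : ∀ x, ‖-Complex.I * Complex.exp (Complex.I * f x)‖ = 1 := fun x => by
    rw [norm_mul, norm_exp_I_mul_ofReal]; simp
  have hb : ‖((f' b)⁻¹ : ℂ) * (-Complex.I * Complex.exp (Complex.I * f b))‖ ≤ 1 / l := by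
    rw [norm_mul, hnorm, mul_one, ← Complex.ofReal_inv, Complex.norm_real]
    exact hinv b (right_mem_Icc.2 hab)
  have ha : ‖((f' a)⁻¹ : ℂ) * (-Complex.I * Complex.exp (Complex.I * f a))‖ ≤ 1 / l := by
    rw [norm_mul, hnorm, mul_one, ← Complex.ofReal_inv, Complex.norm_real]
    exact hinv a (left_mem_Icc.2 hab)
  have hint : ‖∫ x in a..b, ((-(f'' x) / (f' x) ^ 2 : ℝ) : ℂ) *
      (-Complex.I * Complex.exp (Complex.I * f x))‖ ≤ 2 / l := by
    calc _ ≤ ∫ x in a..b, ‖((-(f'' x) / (f' x) ^ 2 : ℝ) : ℂ) *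
          (-Complex.I * Complex.exp (Complex.I * f x))‖ :=
          intervalIntegral.norm_integral_le_integral_norm hab
      _ = ∫ x in a..b, -(-(f'' x) / (f' x) ^ 2) := by
          apply intervalIntegral.integral_congr
          intro x hx
          have h0 := hmono x (hui ▸ hx)
          simp only
          rw [norm_mul, hnorm, mul_one, Complex.norm_real, Real.norm_eq_abs, abs_of_nonpos]
          exact div_nonpos_of_nonpos_of_nonneg (by linarith) (sq_nonneg _)
      _ = (f' a)⁻¹ - (f' b)⁻¹ := by rw [intervalIntegral.integral_neg, hftc]; ring
      _ ≤ 2 / l := by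
          have h1 := abs_le.1 (hinv b (right_mem_Icc.2 hab))
          have h2 := abs_le.1 (hinv a (left_mem_Icc.2 hab))
          have : 2 / l = 1 / l + 1 / l := by ring
          linarith
  rw [hI, hparts]
  calc _ ≤ 1 / l + 1 / l + 2 / l := by
        refine (norm_sub_le _ _).trans
          (add_le_add ((norm_sub_le _ _).trans (add_le_add hb ha)) hint)
    _ = 4 / l := by ring

theorem norm_integral_exp_le_length (hab : a ≤ b) :
    ‖∫ x in a..b, Complex.exp (Complex.I * f x)‖ ≤ b - a := by
  have := intervalIntegral.norm_integral_le_of_norm_le_const (a := a) (b := b) (C := 1)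
    (f := fun x => Complex.exp (Complex.I * f x)) (fun x _ => (norm_exp_I_mul_ofReal _).le)
  rwa [one_mul, abs_of_nonneg (by linarith)] at this

/-- The second derivative test for oscillatory integrals. -/
theorem norm_integral_exp_le_of_deriv2_ge (hab : a ≤ b) (hf : ∀ x, HasDerivAt f (f' x) x)
    (hf' : ∀ x, HasDerivAt f' (f'' x) x) (hc : Continuous f'') {l : ℝ} (hl : 0 < l)
    (h : ∀ x ∈ Icc a b, l ≤ f'' x) :
    ‖∫ x in a..b, Complex.exp (Complex.I * f x)‖ ≤ 10 / √l := by
  have hcf' : Continuous f' := continuous_iff_continuousAt.2 fun x => (hf' x).continuousAt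
  have hcf : Continuous f := continuous_iff_continuousAt.2 fun x => (hf x).continuousAt
  have hgrow : ∀ x ∈ Icc a b, ∀ y ∈ Icc a b, x ≤ y → l * (y - x) ≤ f' y - f' x := by
    apply (convex_Icc a b).mul_sub_le_image_sub_of_le_deriv hcf'.continuousOn
      (fun x _ => (hf' x).differentiableAt.differentiableWithinAt)
    intro x hx
    rw [(hf' x).deriv]
    exact h x (interior_subset hx)
  obtain ⟨c, hcm, hright, hleft⟩ : ∃ c ∈ Icc a b, (∀ x ∈ Icc a b, c < x → l * (x - c) ≤ f' x) ∧
      (∀ x ∈ Icc a b, x < c → f' x ≤ -(l * (c - x))) := by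
    have haI := left_mem_Icc.2 hab
    have hbI := right_mem_Icc.2 hab
    rcases le_or_gt 0 (f' a) with h0 | h0
    · refine ⟨a, haI, fun x hx hxa => ?_, fun x hx hxa => absurd hxa hx.1.not_gt⟩
      linarith [hgrow a haI x hx hxa.le]
    · rcases le_or_gt (f' b) 0 with h1 | h1
      · refine ⟨b, hbI, fun x hx hxb => ?_, fun x hx hxb => ?_⟩
        · exact absurd hxb hx.2.not_gt
        · linarith [hgrow x hx b hbI hxb.le]
      · obtain ⟨c, hc, hc0⟩ := intermediate_value_Icc hab hcf'.continuousOn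
          (show (0 : ℝ) ∈ Icc (f' a) (f' b) from ⟨h0.le, h1.le⟩)
        refine ⟨c, hc, fun x hx hxc => ?_, fun x hx hxc => ?_⟩
        · linarith [hgrow c hc x hx hxc.le]
        · linarith [hgrow x hx c hc hxc.le]
  have hsq : 0 < √l := Real.sqrt_pos.2 hl
  set η := 1 / √l with hη
  have hη0 : 0 < η := by positivity
  have hlη : l * η = √l := by
    rw [hη]; field_simp; exact (Real.sq_sqrt hl.le).symm
  have hii : ∀ u v : ℝ, IntervalIntegrable (fun x => Complex.exp (Complex.I * f x)) volume u v :=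
    fun u v => Continuous.intervalIntegrable (by fun_prop) _ _
  have hbound : ∀ u v : ℝ, a ≤ u → u ≤ v → v ≤ b →
      ((∀ x ∈ Icc u v, √l ≤ f' x) ∨ (∀ x ∈ Icc u v, f' x ≤ -√l)) →
      ‖∫ x in u..v, Complex.exp (Complex.I * f x)‖ ≤ 4 / √l := fun u v hu huv hv hyp =>
    norm_integral_exp_le_of_deriv_ge huv hf hf' hc
      (fun x hx => hl.le.trans (h x ⟨hu.trans hx.1, hx.2.trans hv⟩)) hsq hyp
  set u := max a (c - η)
  set v := min b (c + η)
  have huc : u ≤ c := max_le hcm.1 (by linarith)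
  have hcv : c ≤ v := le_min hcm.2 (by linarith)
  have h1 : ‖∫ x in a..u, Complex.exp (Complex.I * f x)‖ ≤ 4 / √l := by
    rcases le_total (c - η) a with hca | hca
    · have : u = a := max_eq_left hca
      rw [this, intervalIntegral.integral_same, norm_zero]; positivity
    · have hu : u = c - η := max_eq_right hca
      refine hbound a u le_rfl (le_max_left _ _) (huc.trans hcm.2) (Or.inr fun x hx => ?_)
      have h2 := hleft x ⟨hx.1, hx.2.trans (huc.trans hcm.2)⟩ (by linarith [hx.2])
      have h3 : l * η ≤ l * (c - x) := mul_le_mul_of_nonneg_left (by linarith [hx.2]) hl.le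
      linarith
  have h2 : ‖∫ x in v..b, Complex.exp (Complex.I * f x)‖ ≤ 4 / √l := by
    rcases le_total b (c + η) with hca | hca
    · have : v = b := min_eq_left hca
      rw [this, intervalIntegral.integral_same, norm_zero]; positivity
    · have hu : v = c + η := min_eq_right hca
      refine hbound v b (hcm.1.trans hcv) (min_le_left _ _) le_rfl (Or.inl fun x hx => ?_)
      have h2 := hright x ⟨hcm.1.trans (hcv.trans hx.1), hx.2⟩ (by linarith [hx.1])
      have h3 : l * η ≤ l * (x - c) := mul_le_mul_of_nonneg_left (by linarith [hx.1]) hl.le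
      linarith
  have h3 : ‖∫ x in u..v, Complex.exp (Complex.I * f x)‖ ≤ 2 / √l := by
    refine (norm_integral_exp_le_length (huc.trans hcv)).trans ?_
    have h4 : v ≤ c + η := min_le_right _ _
    have h5 : c - η ≤ u := le_max_right _ _
    have : 2 / √l = 2 * η := by rw [hη]; ring
    linarith
  rw [← intervalIntegral.integral_add_adjacent_intervals (hii a u) (hii u b),
    ← intervalIntegral.integral_add_adjacent_intervals (hii u v) (hii v b)]
  calc _ ≤ 4 / √l + (2 / √l + 4 / √l) :=
        (norm_add_le _ _).trans (add_le_add h1 ((norm_add_le _ _).trans (add_le_add h3 h2)))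
    _ = 10 / √l := by ring

end VanDerCorput

section BesselBound

open Set Real

/-- The half-period Bessel integral. -/
def besselHalf (ν t : ℝ) : ℂ :=
  ∫ x in (0 : ℝ)..π, Complex.exp (Complex.I * ((ν * x - t * sin x : ℝ) : ℂ))

variable {ν t δ : ℝ}

theorem hasDerivAt_besselPhase (ν t x : ℝ) :
    HasDerivAt (fun x => ν * x - t * sin x) (ν - t * cos x) x := by
  simpa [Pi.sub_def] using
    ((hasDerivAt_id x).const_mul ν).sub ((hasDerivAt_sin x).const_mul t)

theorem hasDerivAt_besselPhase_deriv (ν t x : ℝ) :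
    HasDerivAt (fun x => ν - t * cos x) (t * sin x) x := by
  simpa using ((hasDerivAt_cos x).const_mul t).const_sub ν

theorem norm_besselHalf_le_add (hν : 0 ≤ ν) (ht : 1 ≤ t) (hδ : 0 < δ) (hδ1 : δ ≤ 1) :
    ‖besselHalf ν t‖ ≤
      ‖∫ x in (0 : ℝ)..δ, Complex.exp (Complex.I * ((ν * x - t * sin x : ℝ) : ℂ))‖ +
        28 / √(t * δ) := by
  have ht0 : 0 < t := by linarith
  have hπ := Real.pi_gt_three
  have hπ4 := Real.pi_le_four
  have hii : ∀ u v : ℝ, IntervalIntegrable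
      (fun x : ℝ => Complex.exp (Complex.I * ((ν * x - t * sin x : ℝ) : ℂ))) volume u v :=
    fun u v => Continuous.intervalIntegrable (by fun_prop) _ _
  have h1 : ‖∫ x in δ..(π - δ), Complex.exp (Complex.I * ((ν * x - t * sin x : ℝ) : ℂ))‖
      ≤ 10 / √(t * δ / 4) := by
    have := norm_integral_exp_le_of_deriv2_ge (a := δ) (b := π - δ) (by linarith)
      (hasDerivAt_besselPhase ν t) (hasDerivAt_besselPhase_deriv ν t) (by fun_prop)
      (l := t * δ / 4) (by positivity) (fun x hx => ?_)
    · exact this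
    have hsin : δ / 4 ≤ sin x := by
      rcases le_total x (π / 2) with hx2 | hx2
      · have h := mul_le_sin (by linarith [hx.1] : 0 ≤ x) hx2
        have : δ / 4 ≤ 2 / π * x := by
          rw [div_mul_eq_mul_div, div_le_div_iff₀ (by norm_num) (by linarith)]
          nlinarith [hx.1]
        linarith
      · have h := mul_le_sin (by linarith [hx.2] : 0 ≤ π - x) (by linarith)
        rw [sin_pi_sub] at h
        have : δ / 4 ≤ 2 / π * (π - x) := by
          rw [div_mul_eq_mul_div, div_le_div_iff₀ (by norm_num) (by linarith)]
          nlinarith [hx.2]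
        linarith
    calc t * δ / 4 = t * (δ / 4) := by ring
      _ ≤ t * sin x := mul_le_mul_of_nonneg_left hsin ht0.le
  have h2 : ‖∫ x in (π - δ)..π, Complex.exp (Complex.I * ((ν * x - t * sin x : ℝ) : ℂ))‖
      ≤ 4 / (t / 2) := by
    refine norm_integral_exp_le_of_deriv_ge (by linarith)
      (hasDerivAt_besselPhase ν t) (hasDerivAt_besselPhase_deriv ν t) (by fun_prop)
      (fun x hx => mul_nonneg ht0.le (sin_nonneg_of_nonneg_of_le_pi (by linarith [hx.1]) hx.2))
      (by positivity) (Or.inl fun x hx => ?_)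
    have hcos : 1 / 2 ≤ cos (π - x) := by
      have := one_sub_sq_div_two_le_cos (x := π - x)
      nlinarith [hx.1, hx.2]
    rw [cos_pi_sub] at hcos
    nlinarith
  have h1' : 10 / √(t * δ / 4) = 20 / √(t * δ) := by
    rw [show t * δ / 4 = t * δ / 2 ^ 2 by ring, Real.sqrt_div' _ (by norm_num),
      Real.sqrt_sq (by norm_num)]
    field_simp; norm_num
  have h2' : 4 / (t / 2) ≤ 8 / √(t * δ) := by
    have : √(t * δ) ≤ t := by
      rw [Real.sqrt_le_left ht0.le]; nlinarith
    rw [show 4 / (t / 2) = 8 / t by field_simp; norm_num]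
    exact div_le_div_of_nonneg_left (by norm_num) (by positivity) this
  unfold besselHalf
  rw [← intervalIntegral.integral_add_adjacent_intervals (hii 0 δ) (hii δ π),
    ← intervalIntegral.integral_add_adjacent_intervals (hii δ (π - δ)) (hii (π - δ) π)]
  calc _ ≤ _ + (20 / √(t * δ) + 8 / √(t * δ)) :=
        (norm_add_le _ _).trans (add_le_add_right ((norm_add_le _ _).trans
          (add_le_add (h1.trans h1'.le) (h2.trans h2'))) _)
    _ = _ := by ring

/-- Uniform decay of the Bessel integral away from the turning point. -/
theorem norm_besselHalf_le (hν : 0 ≤ ν) (ht : 1 ≤ t) :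
    ‖besselHalf ν t‖ ≤ 100 * (t * (1 + min t |t - ν|)) ^ (-(1 / 4) : ℝ) := by
  have ht0 : 0 < t := by linarith
  set s := min t |t - ν| with hs
  have hs0 : 0 ≤ s := le_min ht0.le (abs_nonneg _)
  have hst : s ≤ t := min_le_left _ _
  have key : ∀ y : ℝ, 0 < y → t * (1 + s) ≤ 2 * y →
      y ^ (-(1 / 4) : ℝ) ≤ 2 * (t * (1 + s)) ^ (-(1 / 4) : ℝ) := by
    intro y hy hle
    have h1 : (2 * y) ^ (-(1 / 4) : ℝ) ≤ (t * (1 + s)) ^ (-(1 / 4) : ℝ) :=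
      Real.rpow_le_rpow_of_nonpos (by positivity) hle (by norm_num)
    rw [Real.mul_rpow (by norm_num) hy.le] at h1
    have h2 : (1 / 2 : ℝ) ≤ (2 : ℝ) ^ (-(1 / 4) : ℝ) := by
      calc (1 / 2 : ℝ) = (2 : ℝ) ^ (-1 : ℝ) := by rw [Real.rpow_neg_one]; norm_num
        _ ≤ _ := Real.rpow_le_rpow_of_exponent_le (by norm_num) (by norm_num)
    have h3 : 0 ≤ y ^ (-(1 / 4) : ℝ) := by positivity
    nlinarith
  rcases le_or_gt s (t ^ (1 / 3 : ℝ)) with hcase | hcase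
  · have hone : 1 ≤ t ^ (1 / 3 : ℝ) := Real.one_le_rpow ht (by norm_num)
    set δ := t ^ (-(1 / 3) : ℝ) with hδ
    have hδ0 : 0 < δ := by positivity
    have hδ1 : δ ≤ 1 := Real.rpow_le_one_of_one_le_of_nonpos ht (by norm_num)
    have h1 := norm_besselHalf_le_add hν ht hδ0 hδ1
    have h2 := norm_integral_exp_le_length (f := fun x => ν * x - t * sin x) hδ0.le
    have h3 : 28 / √(t * δ) = 28 * δ := by
      have : t * δ = t ^ (2 / 3 : ℝ) := by
        nth_rw 1 [← Real.rpow_one t]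
        rw [hδ, ← Real.rpow_add ht0]; norm_num
      rw [this, Real.sqrt_eq_rpow, ← Real.rpow_mul ht0.le, div_eq_mul_inv,
        ← Real.rpow_neg ht0.le, hδ]
      norm_num
    have h4 := key (t ^ (4 / 3 : ℝ)) (by positivity) (by
      have : t ^ (4 / 3 : ℝ) = t * t ^ (1 / 3 : ℝ) := by
        nth_rw 2 [← Real.rpow_one t]
        rw [← Real.rpow_add ht0]; norm_num
      rw [this]; nlinarith)
    rw [← Real.rpow_mul ht0.le, show (4 / 3 : ℝ) * -(1 / 4) = -(1 / 3) by norm_num] at h4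
    have h5 : 0 < (t * (1 + s)) ^ (-(1 / 4) : ℝ) := by positivity
    linarith
  · have hs1 : 1 ≤ s := (Real.one_le_rpow ht (by norm_num)).trans hcase.le
    have hs0' : 0 < s := by linarith
    have hs3 : t ≤ s ^ 3 := by
      calc t = (t ^ (1 / 3 : ℝ)) ^ 3 := by
            rw [← Real.rpow_natCast, ← Real.rpow_mul ht0.le]; norm_num
        _ ≤ s ^ 3 := by gcongr
    set δ := √(s / t) with hδ
    have hδ0 : 0 < δ := Real.sqrt_pos.2 (by positivity)
    have hδ1 : δ ≤ 1 := Real.sqrt_le_one.2 ((div_le_one ht0).2 hst)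
    have hδ2 : t * δ ^ 2 = s := by rw [hδ, Real.sq_sqrt (by positivity)]; field_simp
    have h1 := norm_besselHalf_le_add hν ht hδ0 hδ1
    have hsν : s ≤ |t - ν| := min_le_right _ _
    have hπ := Real.pi_gt_three
    have h2 : ‖∫ x in (0 : ℝ)..δ, Complex.exp (Complex.I * ((ν * x - t * sin x : ℝ) : ℂ))‖
        ≤ 4 / (s / 2) := by
      refine norm_integral_exp_le_of_deriv_ge hδ0.le
        (hasDerivAt_besselPhase ν t) (hasDerivAt_besselPhase_deriv ν t) (by fun_prop)
        (fun x hx => mul_nonneg ht0.le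
          (sin_nonneg_of_nonneg_of_le_pi hx.1 (by linarith [hx.2])))
        (by positivity) ?_
      rcases le_total t ν with htν | htν
      · left
        intro x hx
        rw [abs_of_nonpos (by linarith)] at hsν
        nlinarith [Real.cos_le_one x]
      · right
        intro x hx
        rw [abs_of_nonneg (by linarith)] at hsν
        have h3 := one_sub_sq_div_two_le_cos (x := x)
        have h4 : x ^ 2 ≤ δ ^ 2 := by have := hx.1; have := hx.2; gcongr
        nlinarith
    have h3 : √(t * δ) = (t * s) ^ (1 / 4 : ℝ) := by
      have : t * δ = √(t * s) := by
        rw [eq_comm, Real.sqrt_eq_iff_mul_self_eq (by positivity) (by positivity)]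
        nlinarith
      rw [this, Real.sqrt_eq_rpow, Real.sqrt_eq_rpow, ← Real.rpow_mul (by positivity)]
      norm_num
    have h4 : (t * s) ^ (1 / 4 : ℝ) ≤ s := by
      calc (t * s) ^ (1 / 4 : ℝ) ≤ (s ^ 4) ^ (1 / 4 : ℝ) := by
            gcongr; nlinarith
        _ = s := by rw [← Real.rpow_natCast, ← Real.rpow_mul hs0]; norm_num
    have h5 := key (t * s) (by positivity) (by nlinarith)
    have h6 : 4 / (s / 2) ≤ 8 * (t * s) ^ (-(1 / 4) : ℝ) := by
      rw [show 4 / (s / 2) = 8 * s⁻¹ by field_simp; norm_num, Real.rpow_neg (by positivity)]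
      gcongr
    have h7 : 28 / √(t * δ) = 28 * (t * s) ^ (-(1 / 4) : ℝ) := by
      rw [h3, Real.rpow_neg (by positivity), div_eq_mul_inv]
    have h8 : 0 < (t * (1 + s)) ^ (-(1 / 4) : ℝ) := by positivity
    linarith

end BesselBound

section BesselCoeff

open Set Real

/-- The Fourier coefficients of `exp (-i t cos)`. -/
def besselCoeff (n : ℤ) (t : ℝ) : ℂ :=
  ∫ x : UnitAddCircle, fourier n x * Complex.exp (-(Complex.I * t * ((fourier 1 x : ℂ).re : ℂ)))

theorem norm_exp_neg_I_mul (t s : ℝ) : ‖Complex.exp (-(Complex.I * t * (s : ℂ)))‖ = 1 := by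
  rw [Complex.norm_exp]; simp

theorem norm_besselCoeff_le_one (n : ℤ) (t : ℝ) : ‖besselCoeff n t‖ ≤ 1 := by
  have := norm_integral_le_of_norm_le_const (μ := (volume : Measure UnitAddCircle)) (C := 1)
    (f := fun x : UnitAddCircle =>
      fourier n x * Complex.exp (-(Complex.I * t * ((fourier 1 x : ℂ).re : ℂ))))
    (Eventually.of_forall fun x => by
      rw [norm_mul, norm_exp_neg_I_mul, mul_one]; exact (Circle.norm_coe _).le)
  have h1 : volume.real (univ : Set UnitAddCircle) = 1 := by
    simp [Measure.real]
  rwa [h1, one_mul] at this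

theorem continuous_besselCoeff (n : ℤ) : Continuous (besselCoeff n) := by
  unfold besselCoeff
  refine continuous_of_dominated (bound := fun _ => 1) (fun t => ?_) (fun t => ?_) ?_ ?_
  · exact Continuous.aestronglyMeasurable (by fun_prop)
  · exact Eventually.of_forall fun x => by
      rw [norm_mul, norm_exp_neg_I_mul, mul_one]
      exact (Circle.norm_coe _).le
  · exact integrable_const _
  · exact Eventually.of_forall fun x => by fun_prop

theorem norm_besselHalf_neg (ν t : ℝ) : ‖besselHalf (-ν) t‖ = ‖besselHalf ν t‖ := by
  have h : besselHalf ν t = Complex.exp (Complex.I * ((ν * π : ℝ) : ℂ)) * besselHalf (-ν) t := by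
    unfold besselHalf
    rw [← intervalIntegral.integral_const_mul]
    have := intervalIntegral.integral_comp_sub_left (a := 0) (b := π)
      (fun x => Complex.exp (Complex.I * ((ν * x - t * sin x : ℝ) : ℂ))) π
    rw [sub_self, sub_zero] at this
    rw [← this]
    refine intervalIntegral.integral_congr fun x _ => ?_
    rw [← Complex.exp_add, sin_pi_sub]
    congr 1
    push_cast; ring
  rw [h, norm_mul, norm_exp_I_mul_ofReal, one_mul]

theorem besselCoeff_eq_interval (n : ℤ) (t : ℝ) :
    besselCoeff n t = Complex.exp (-(Complex.I * (n * (π / 2)))) * (1 / (2 * π)) *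
      ∫ x in (0 : ℝ)..(2 * π), Complex.exp (Complex.I * ((n * x - t * sin x : ℝ) : ℂ)) := by
  unfold besselCoeff
  rw [← UnitAddCircle.intervalIntegral_preimage (-(1 / 4))]
  have := intervalIntegral.integral_comp_mul_add (a := -(1 / 4)) (b := -(1 / 4) + 1)
    (fun x => Complex.exp (Complex.I * ((n * x - t * sin x : ℝ) : ℂ)))
    (c := 2 * π) (by positivity) (π / 2)
  have h0 : 2 * π * -(1 / 4) + π / 2 = 0 := by ring
  have h1 : 2 * π * (-(1 / 4) + 1) + π / 2 = 2 * π := by ring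
  rw [h0, h1] at this
  rw [mul_assoc, show (1 / (2 * (π : ℂ))) = (((2 * π)⁻¹ : ℝ) : ℂ) by push_cast; ring,
    ← Complex.real_smul, ← this, ← intervalIntegral.integral_const_mul]
  refine intervalIntegral.integral_congr fun x _ => ?_
  have hre : (fourier 1 (x : UnitAddCircle) : ℂ).re = cos (2 * π * x) := by
    rw [fourier_coe_apply]
    rw [show (2 * π * Complex.I * ((1 : ℤ) : ℂ) * (x : ℂ) / ((1 : ℝ) : ℂ) : ℂ)
      = ((2 * π * x : ℝ) : ℂ) * Complex.I by push_cast; ring, Complex.exp_ofReal_mul_I_re]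
  rw [hre, fourier_coe_apply, ← Complex.exp_add, ← Complex.exp_add, Real.sin_add_pi_div_two]
  congr 1
  push_cast; ring

theorem norm_besselCoeff_le_besselHalf (n : ℤ) (t : ℝ) :
    ‖besselCoeff n t‖ ≤ ‖besselHalf |(n : ℝ)| t‖ := by
  have hii : ∀ u v : ℝ, IntervalIntegrable
      (fun x : ℝ => Complex.exp (Complex.I * ((n * x - t * sin x : ℝ) : ℂ))) volume u v :=
    fun u v => Continuous.intervalIntegrable (by fun_prop) _ _
  have habs : ‖besselHalf |(n : ℝ)| t‖ = ‖besselHalf n t‖ := by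
    rcases abs_choice (n : ℝ) with h | h <;> rw [h]
    exact norm_besselHalf_neg _ _
  have h2 : ∫ x in π..(2 * π), Complex.exp (Complex.I * ((n * x - t * sin x : ℝ) : ℂ))
      = (starRingEnd ℂ) (besselHalf n t) := by
    have := intervalIntegral.integral_comp_sub_left (a := 0) (b := π)
      (fun x => Complex.exp (Complex.I * ((n * x - t * sin x : ℝ) : ℂ))) (2 * π)
    rw [show 2 * π - π = π by ring, sub_zero] at this
    rw [← this, besselHalf, ← intervalIntegral.intervalIntegral_conj]
    refine intervalIntegral.integral_congr fun x _ => ?_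
    rw [← Complex.exp_conj, Real.sin_two_pi_sub]
    rw [show Complex.I * ((n * (2 * π - x) - t * -sin x : ℝ) : ℂ)
      = n * (2 * π * Complex.I) + (starRingEnd ℂ) (Complex.I * ((n * x - t * sin x : ℝ) : ℂ)) by
        rw [map_mul, Complex.conj_I, Complex.conj_ofReal]; push_cast; ring,
      Complex.exp_add, Complex.exp_int_mul_two_pi_mul_I, one_mul]
  have hpi : (1 : ℝ) ≤ π := by linarith [Real.pi_gt_three]
  rw [besselCoeff_eq_interval, ← intervalIntegral.integral_add_adjacent_intervals (hii 0 π)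
    (hii π (2 * π)), h2, habs, norm_mul, norm_mul,
    show -(Complex.I * (n * (π / 2) : ℂ)) = Complex.I * ((-(n * (π / 2)) : ℝ) : ℂ) by
      push_cast; ring, norm_exp_I_mul_ofReal, one_mul]
  have h3 : ‖(1 / (2 * π) : ℂ)‖ = 1 / (2 * π) := by
    rw [show (1 / (2 * π) : ℂ) = ((1 / (2 * π) : ℝ) : ℂ) by push_cast; rfl, Complex.norm_real,
      Real.norm_of_nonneg (by positivity)]
  have h4 : ‖besselHalf n t + (starRingEnd ℂ) (besselHalf n t)‖ ≤ 2 * ‖besselHalf n t‖ := by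
    refine (norm_add_le _ _).trans ?_
    rw [RCLike.norm_conj]; linarith
  rw [h3]
  calc 1 / (2 * π) * _ ≤ 1 / (2 * π) * (2 * ‖besselHalf n t‖) := by
        gcongr; exact h4
    _ = ‖besselHalf n t‖ / π := by field_simp
    _ ≤ ‖besselHalf n t‖ := div_le_self (norm_nonneg _) hpi

/-- The dispersive bound for the one-dimensional lattice propagator. -/
theorem norm_besselCoeff_le (n : ℤ) {t : ℝ} (ht : 0 < t) :
    ‖besselCoeff n t‖ ≤
      200 * ((1 + t) * (1 + min t |(t - |(n : ℝ)|)|)) ^ (-(1 / 4) : ℝ) := by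
  set w := min t |(t - |(n : ℝ)|)| with hw
  have hw0 : 0 ≤ w := le_min ht.le (abs_nonneg _)
  have hwt : w ≤ t := min_le_left _ _
  have half : (1 / 2 : ℝ) ≤ (4 : ℝ) ^ (-(1 / 4) : ℝ) := by
    calc (1 / 2 : ℝ) = (4 : ℝ) ^ (-(1 / 2) : ℝ) := by
          rw [show (4 : ℝ) = 2 ^ (2 : ℝ) by norm_num, ← Real.rpow_mul (by norm_num)]
          norm_num [Real.rpow_neg_one]
      _ ≤ _ := Real.rpow_le_rpow_of_exponent_le (by norm_num) (by norm_num)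
  rcases le_total 1 t with h1 | h1
  · refine (norm_besselCoeff_le_besselHalf n t).trans
      ((norm_besselHalf_le (abs_nonneg _) h1).trans ?_)
    rw [← hw]
    have h2 : (4 * (t * (1 + w))) ^ (-(1 / 4) : ℝ) ≤ ((1 + t) * (1 + w)) ^ (-(1 / 4) : ℝ) :=
      Real.rpow_le_rpow_of_nonpos (by positivity) (by nlinarith) (by norm_num)
    rw [Real.mul_rpow (by norm_num) (by positivity)] at h2
    have h3 : 0 < (t * (1 + w)) ^ (-(1 / 4) : ℝ) := by positivity
    nlinarith
  · refine (norm_besselCoeff_le_one n t).trans ?_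
    have h2 : (4 : ℝ) ^ (-(1 / 4) : ℝ) ≤ ((1 + t) * (1 + w)) ^ (-(1 / 4) : ℝ) :=
      Real.rpow_le_rpow_of_nonpos (by positivity) (by nlinarith) (by norm_num)
    linarith

end BesselCoeff

section Propagator

open Set Real UnitAddTorus

variable {d : ℕ}

/-- The symbol `∑ cos` of the discrete Laplacian on the torus. -/
def symbol (d : ℕ) (x : UnitAddTorus (Fin d)) : ℝ := ∑ j, (fourier 1 (x j) : ℂ).re

theorem continuous_symbol (d : ℕ) : Continuous (symbol d) := by
  unfold symbol; fun_prop

/-- The normalized Haar measure on the torus. -/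
abbrev torusMeasure (d : ℕ) : Measure (UnitAddTorus (Fin d)) :=
  Measure.pi fun _ => AddCircle.haarAddCircle

/-- The integral kernel of `exp (-i t Δ)`. -/
def propagator (t : ℝ) (n : Lattice d) : ℂ := ∏ i, besselCoeff (n i) t

theorem continuous_propagator (n : Lattice d) : Continuous fun t => propagator t n :=
  continuous_finsetProd _ fun i _ => continuous_besselCoeff (n i)

theorem norm_mFourier_apply (n : Fin d → ℤ) (x : UnitAddTorus (Fin d)) : ‖mFourier n x‖ = 1 := by
  simp only [mFourier, ContinuousMap.coe_mk, norm_prod]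
  exact Finset.prod_eq_one fun i _ => Circle.norm_coe _

theorem propagator_eq_integral (t : ℝ) (n : Lattice d) :
    propagator t n =
      ∫ x : UnitAddTorus (Fin d), mFourier n x *
        Complex.exp (-(Complex.I * t * (symbol d x : ℂ))) ∂torusMeasure d := by
  have := integral_fintype_prod_eq_prod (𝕜 := ℂ) (ι := Fin d) (E := fun _ => UnitAddCircle)
    (μ := fun _ => AddCircle.haarAddCircle)
    (fun i x => fourier (n i) x * Complex.exp (-(Complex.I * t * ((fourier 1 x : ℂ).re : ℂ))))
  have hB : ∀ n : ℤ, besselCoeff n t = ∫ x : UnitAddCircle,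
      fourier n x * Complex.exp (-(Complex.I * t * ((fourier 1 x : ℂ).re : ℂ)))
        ∂AddCircle.haarAddCircle := fun n => by
    rw [AddCircle.integral_haarAddCircle, inv_one, one_smul, besselCoeff]
  simp_rw [propagator, hB]
  rw [← this]
  refine integral_congr_ae (Eventually.of_forall fun x => ?_)
  simp only [mFourier, ContinuousMap.coe_mk, Finset.prod_mul_distrib, symbol]
  rw [← Complex.exp_sum]
  push_cast
  rw [Finset.mul_sum, Finset.sum_neg_distrib]

/-- The square-summable sequence of Fourier coefficients of a continuous function on the torus. -/
def fourierSeq (h : C(UnitAddTorus (Fin d), ℂ)) : L2 d :=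
  mFourierBasis.repr (ContinuousMap.toLp 2 (torusMeasure d) ℂ h)

theorem fourierSeq_apply (h : C(UnitAddTorus (Fin d), ℂ)) (n : Lattice d) :
    fourierSeq h n = ∫ x, mFourier (-n) x * h x ∂torusMeasure d := by
  rw [fourierSeq, mFourierBasis_repr]
  exact mFourierCoeff_toLp h n

theorem hasSum_sq_fourierSeq (h : C(UnitAddTorus (Fin d), ℂ)) :
    HasSum (fun n => ‖fourierSeq h n‖ ^ 2) (∫ x, ‖h x‖ ^ 2 ∂torusMeasure d) := by
  have h1 : HasSum (fun n => ‖fourierSeq h n‖ ^ 2) (∫ x,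
      ‖(ContinuousMap.toLp 2 (torusMeasure d) ℂ h : UnitAddTorus (Fin d) → ℂ) x‖ ^ 2
        ∂torusMeasure d) := by
    simp_rw [fourierSeq, mFourierBasis_repr]
    exact hasSum_sq_mFourierCoeff _
  convert h1 using 1
  refine integral_congr_ae ?_
  filter_upwards [ContinuousMap.coeFn_toLp (p := 2) (𝕜 := ℂ) (torusMeasure d) h] with x hx
  rw [hx]

/-- The continuous function `exp (-i t symbol)` on the torus. -/
def propagatorSymbol (d : ℕ) (t : ℝ) : C(UnitAddTorus (Fin d), ℂ) where
  toFun x := Complex.exp (-(Complex.I * t * (symbol d x : ℂ)))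
  continuous_toFun := by
    have := continuous_symbol d
    fun_prop

theorem fourierSeq_propagatorSymbol (t : ℝ) (n : Lattice d) :
    fourierSeq (propagatorSymbol d t) n = propagator t (-n) := by
  rw [fourierSeq_apply, propagator_eq_integral]
  simp only [propagatorSymbol, ContinuousMap.coe_mk]

theorem hasSum_sq_propagator (t : ℝ) : HasSum (fun n : Lattice d => ‖propagator t n‖ ^ 2) 1 := by
  have h1 := hasSum_sq_fourierSeq (propagatorSymbol d t)
  have h2 : ∫ x, ‖propagatorSymbol d t x‖ ^ 2 ∂torusMeasure d = 1 := by
    have h : ∀ x, ‖propagatorSymbol d t x‖ ^ 2 = 1 := fun x => by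
      rw [propagatorSymbol, ContinuousMap.coe_mk, norm_exp_neg_I_mul, one_pow]
    simp_rw [h]
    simp
  rw [h2] at h1
  simp_rw [fourierSeq_propagatorSymbol] at h1
  exact (Equiv.neg (Lattice d)).hasSum_iff.1 h1

theorem tsum_enorm_sq_propagator (t : ℝ) :
    ∑' n : Lattice d, ‖propagator t n‖ₑ ^ 2 = 1 := by
  have h5 : ∀ n : Lattice d, ‖propagator t n‖ₑ ^ 2 = ENNReal.ofReal (‖propagator t n‖ ^ 2) :=
    fun n => by rw [ENNReal.ofReal_pow (norm_nonneg _), ofReal_norm]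
  simp_rw [h5]
  rw [← ENNReal.ofReal_tsum_of_nonneg (fun n => by positivity) (hasSum_sq_propagator t).summable,
    (hasSum_sq_propagator t).tsum_eq, ENNReal.ofReal_one]

theorem norm_propagator_rpow_le (hd : 0 < d) (n : Lattice d) {t : ℝ} (ht : 0 < t) {β c : ℝ}
    (hβ : 0 ≤ β) (hc : c ≤ d * β / 4) :
    ‖propagator t n‖ ^ β * (1 + t) ^ c ≤ ∑ i, 200 ^ (d * β) *
      ((1 + |t|) ^ (-(d * β / 2 - c)) + (1 + |(t - |(n i : ℝ)|)|) ^ (-(d * β / 2 - c))) := by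
  have : NeZero d := ⟨hd.ne'⟩
  set u : Fin d → ℝ := fun i => 1 + min t |(t - |(n i : ℝ)|)| with hu
  obtain ⟨i, -, hi⟩ := Finset.exists_min_image Finset.univ u ⟨0, Finset.mem_univ _⟩
  have hu1 : ∀ j, 1 ≤ u j := fun j => by
    have : 0 ≤ min t |(t - |(n j : ℝ)|)| := le_min ht.le (abs_nonneg _)
    simp only [hu]; linarith
  have hui : 0 < u i := by linarith [hu1 i]
  have hut : u i ≤ 1 + t := by simp only [hu]; linarith [min_le_left t |(t - |(n i : ℝ)|)|]
  have h1 : ‖propagator t n‖ ≤ (200 * ((1 + t) * u i) ^ (-(1 / 4) : ℝ)) ^ d := by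
    rw [propagator, norm_prod]
    refine (Finset.prod_le_prod (fun j _ => norm_nonneg _) (fun j _ =>
      (norm_besselCoeff_le (n j) ht).trans (?_ : _ ≤ 200 * ((1 + t) * u i) ^ (-(1 / 4) : ℝ)))).trans
      (by simp)
    gcongr 200 * ?_
    refine Real.rpow_le_rpow_of_nonpos (by positivity) ?_ (by norm_num)
    exact mul_le_mul_of_nonneg_left (hi j (Finset.mem_univ _)) (by linarith)
  have h2 : ‖propagator t n‖ ^ β ≤
      200 ^ (d * β) * ((1 + t) ^ (-(d * β / 4)) * (u i) ^ (-(d * β / 4))) := by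
    refine (Real.rpow_le_rpow (norm_nonneg _) h1 hβ).trans_eq ?_
    rw [← Real.rpow_natCast, ← Real.rpow_mul (by positivity), Real.mul_rpow (by norm_num)
      (by positivity), ← Real.rpow_mul (by positivity), Real.mul_rpow (by positivity) hui.le]
    ring_nf
  have h3 : (1 + t) ^ (-(d * β / 4)) * (1 + t) ^ c ≤ (u i) ^ (-(d * β / 4 - c)) := by
    rw [← Real.rpow_add (by positivity), show -(d * β / 4) + c = -(d * β / 4 - c) by ring]
    exact Real.rpow_le_rpow_of_nonpos hui hut (by linarith)
  have h4 : (u i) ^ (-(d * β / 2 - c)) ≤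
      (1 + |t|) ^ (-(d * β / 2 - c)) + (1 + |(t - |(n i : ℝ)|)|) ^ (-(d * β / 2 - c)) := by
    rw [abs_of_pos ht]
    rcases min_choice t |(t - |(n i : ℝ)|)| with h | h
    · simp only [hu, h]
      exact le_add_of_nonneg_right (by positivity)
    · simp only [hu, h]
      exact le_add_of_nonneg_left (by positivity)
  calc ‖propagator t n‖ ^ β * (1 + t) ^ c
      ≤ 200 ^ (d * β) * ((1 + t) ^ (-(d * β / 4)) * (u i) ^ (-(d * β / 4))) * (1 + t) ^ c := by
        gcongr
    _ = 200 ^ (d * β) * ((u i) ^ (-(d * β / 4)) * ((1 + t) ^ (-(d * β / 4)) * (1 + t) ^ c)) := by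
        ring
    _ ≤ 200 ^ (d * β) * ((u i) ^ (-(d * β / 4)) * (u i) ^ (-(d * β / 4 - c))) := by gcongr
    _ = 200 ^ (d * β) * (u i) ^ (-(d * β / 2 - c)) := by
        rw [← Real.rpow_add hui]; ring_nf
    _ ≤ 200 ^ (d * β) * ((1 + |t|) ^ (-(d * β / 2 - c)) +
          (1 + |(t - |(n i : ℝ)|)|) ^ (-(d * β / 2 - c))) := by gcongr
    _ ≤ _ := Finset.single_le_sum (f := fun i => 200 ^ (d * β) *
        ((1 + |t|) ^ (-(d * β / 2 - c)) + (1 + |(t - |(n i : ℝ)|)|) ^ (-(d * β / 2 - c))))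
        (fun j _ => by positivity) (Finset.mem_univ i)

/-- Bounds uniform in the lattice point for weighted time integrals of powers of the propagator. -/
theorem exists_lintegral_propagator_rpow_le (hd : 0 < d) {β c : ℝ}
    (hβ : 0 ≤ β) (hc : c ≤ d * β / 4) (hbc : 1 < d * β / 2 - c) :
    ∃ C : ℝ≥0∞, C ≠ ∞ ∧ ∀ n : Lattice d,
      ∫⁻ t in Ioi (0 : ℝ), ENNReal.ofReal (‖propagator t n‖ ^ β * (1 + t) ^ c) ≤ C := by
  set e := d * β / 2 - c with he
  set J : ℝ≥0∞ := ∫⁻ t : ℝ, ENNReal.ofReal ((1 + ‖t‖) ^ (-e)) with hJ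
  have hJfin : J < ∞ := finite_integral_one_add_norm (by simpa using hbc)
  refine ⟨∑ _i : Fin d, ENNReal.ofReal (200 ^ (d * β)) * (J + J), ?_, fun n => ?_⟩
  · refine (ENNReal.sum_lt_top.2 fun i _ => ?_).ne
    exact ENNReal.mul_lt_top ENNReal.ofReal_lt_top (ENNReal.add_lt_top.2 ⟨hJfin, hJfin⟩)
  · have hmeas : ∀ ν : ℝ, Measurable fun t : ℝ => ENNReal.ofReal ((1 + |t - ν|) ^ (-e)) := fun ν =>
      ENNReal.measurable_ofReal.comp (by fun_prop)
    have hm0 : Measurable fun t : ℝ => ENNReal.ofReal ((1 + |t|) ^ (-e)) := by simpa using hmeas 0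
    calc ∫⁻ t in Ioi (0 : ℝ), ENNReal.ofReal (‖propagator t n‖ ^ β * (1 + t) ^ c)
        ≤ ∫⁻ t in Ioi (0 : ℝ), ∑ i, ENNReal.ofReal (200 ^ (d * β)) *
          (ENNReal.ofReal ((1 + |t|) ^ (-e)) +
            ENNReal.ofReal ((1 + |(t - |(n i : ℝ)|)|) ^ (-e))) := by
          refine setLIntegral_mono_ae' measurableSet_Ioi (Eventually.of_forall fun t ht => ?_)
          refine (ENNReal.ofReal_le_ofReal (norm_propagator_rpow_le hd n ht hβ hc)).trans_eq ?_
          rw [ENNReal.ofReal_sum_of_nonneg (fun i _ => by positivity)]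
          refine Finset.sum_congr rfl fun i _ => ?_
          rw [ENNReal.ofReal_mul (by positivity),
            ENNReal.ofReal_add (by positivity) (by positivity)]
      _ ≤ ∫⁻ t : ℝ, ∑ i, ENNReal.ofReal (200 ^ (d * β)) *
          (ENNReal.ofReal ((1 + |t|) ^ (-e)) +
            ENNReal.ofReal ((1 + |(t - |(n i : ℝ)|)|) ^ (-e))) := setLIntegral_le_lintegral _ _
      _ = ∑ _i : Fin d, ENNReal.ofReal (200 ^ (d * β)) * (J + J) := by
          have hm : ∀ i, Measurable fun t : ℝ => ENNReal.ofReal ((1 + |t|) ^ (-e)) +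
              ENNReal.ofReal ((1 + |(t - |(n i : ℝ)|)|) ^ (-e)) := fun i => hm0.add (hmeas _)
          rw [lintegral_finsetSum _ (fun i _ => (hm i).const_mul _)]
          refine Finset.sum_congr rfl fun i _ => ?_
          rw [lintegral_const_mul _ (hm i), lintegral_add_left hm0]
          congr 2
          exact lintegral_sub_right_eq_self (fun t : ℝ => ENNReal.ofReal ((1 + |t|) ^ (-e))) _

/-- The time-integrated propagator lies in `ℓ^r` for `r > 2d / (d - 2)`. -/
theorem tsum_lintegral_propagator_rpow_lt_top (hd : 3 ≤ d) {r : ℝ}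
    (hr : 2 * (d : ℝ) / (d - 2) < r) :
    ∑' n : Lattice d, (∫⁻ t in Ioi (0 : ℝ), ‖propagator t n‖ₑ) ^ r < ∞ := by
  have hd3 : (3 : ℝ) ≤ d := by exact_mod_cast hd
  have hr' : 2 * (d : ℝ) < r * (d - 2) := (div_lt_iff₀ (by linarith)).1 hr
  have hr2 : 2 < r := by nlinarith
  have hr1 : 0 < r - 1 := by linarith
  obtain ⟨σ, hσ1, hσ⟩ := exists_between
    (show (1 : ℝ) < min (d * (r - 2) / 4) (d * (r - 2) / 2 - r + 1) from
      lt_min (by nlinarith) (by nlinarith))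
  have hσa := hσ.trans_le (min_le_left _ _)
  have hσb := hσ.trans_le (min_le_right _ _)
  set β := (r - 2) / (r - 1) with hβ
  set c := σ / (r - 1) with hc
  obtain ⟨C, hC, hCn⟩ := exists_lintegral_propagator_rpow_le (d := d) (by omega) (β := β) (c := c)
    (by apply div_nonneg <;> linarith)
    (by rw [hβ, hc, mul_div_assoc', div_div, mul_comm (r - 1) 4, ← div_div]
        exact div_le_div_of_nonneg_right hσa.le hr1.le)
    (by rw [hβ, hc, mul_div_assoc', div_div, mul_comm (r - 1) 2, ← div_div, ← sub_div,
          lt_div_iff₀ hr1]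
        linarith)
  set W : ℝ≥0∞ := ∫⁻ t in Ioi (0 : ℝ), ENNReal.ofReal ((1 + t) ^ (-σ)) with hW
  have hWfin : W < ∞ := by
    refine lt_of_le_of_lt ?_ (finite_integral_one_add_norm (E := ℝ) (μ := volume) (r := σ)
      (by simpa using hσ1))
    refine le_trans (setLIntegral_mono_ae' measurableSet_Ioi (Eventually.of_forall fun t ht => ?_))
      (setLIntegral_le_lintegral (Ioi (0 : ℝ)) _)
    rw [Real.norm_of_nonneg (le_of_lt ht)]
  have hmw : ∀ s : ℝ, Measurable fun t : ℝ => ENNReal.ofReal ((1 + t) ^ s) := fun s =>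
    ENNReal.measurable_ofReal.comp (by fun_prop)
  have hmk : ∀ n : Lattice d, Measurable fun t : ℝ => ‖propagator t n‖ₑ := fun n =>
    (continuous_propagator n).measurable.enorm
  have hkey : ∀ n : Lattice d, (∫⁻ t in Ioi (0 : ℝ), ‖propagator t n‖ₑ) ^ r ≤
      C ^ (r - 1) *
        ∫⁻ t in Ioi (0 : ℝ), ‖propagator t n‖ₑ ^ 2 * ENNReal.ofReal ((1 + t) ^ (-σ)) := by
    intro n
    have hpq : (r / (r - 1)).HolderConjugate r :=
      (Real.HolderConjugate.conjExponent (by linarith)).symm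
    have hold := ENNReal.lintegral_mul_le_Lp_mul_Lq (volume.restrict (Ioi (0 : ℝ))) hpq
      (f := fun t => ‖propagator t n‖ₑ ^ ((r - 2) / r) * ENNReal.ofReal ((1 + t) ^ (σ / r)))
      (g := fun t => ‖propagator t n‖ₑ ^ (2 / r) * ENNReal.ofReal ((1 + t) ^ (-(σ / r))))
      (((hmk n).pow_const _).mul (hmw _)).aemeasurable
      (((hmk n).pow_const _).mul (hmw _)).aemeasurable
    have e0 : ∫⁻ t in Ioi (0 : ℝ), ((fun t => ‖propagator t n‖ₑ ^ ((r - 2) / r) *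
        ENNReal.ofReal ((1 + t) ^ (σ / r))) * (fun t => ‖propagator t n‖ₑ ^ (2 / r) *
          ENNReal.ofReal ((1 + t) ^ (-(σ / r))))) t =
        ∫⁻ t in Ioi (0 : ℝ), ‖propagator t n‖ₑ := by
      refine setLIntegral_congr_fun measurableSet_Ioi fun t ht => ?_
      have ht' : (0 : ℝ) < 1 + t := by have : (0 : ℝ) < t := ht; linarith
      simp only [Pi.mul_apply]
      rw [mul_mul_mul_comm, ← ENNReal.rpow_add_of_nonneg _ _ (by apply div_nonneg <;> linarith)
        (by positivity), ← ENNReal.ofReal_mul (by positivity), ← Real.rpow_add ht']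
      rw [show (r - 2) / r + 2 / r = 1 by field_simp; ring]
      simp
    have e1 : ∫⁻ t in Ioi (0 : ℝ), (‖propagator t n‖ₑ ^ ((r - 2) / r) *
        ENNReal.ofReal ((1 + t) ^ (σ / r))) ^ (r / (r - 1)) ≤ C := by
      refine le_trans (le_of_eq ?_) (hCn n)
      refine setLIntegral_congr_fun measurableSet_Ioi fun t ht => ?_
      have ht' : (0 : ℝ) < 1 + t := by have : (0 : ℝ) < t := ht; linarith
      have hnn : 0 ≤ r / (r - 1) := by apply div_nonneg <;> linarith
      rw [ENNReal.mul_rpow_of_nonneg _ _ hnn, ← ENNReal.rpow_mul,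
        ENNReal.ofReal_rpow_of_nonneg (by positivity) hnn, ← Real.rpow_mul ht'.le,
        ENNReal.ofReal_mul (by positivity), ← ENNReal.ofReal_rpow_of_nonneg (norm_nonneg _)
          (by apply div_nonneg <;> linarith), ofReal_norm]
      rw [hβ, hc]
      have hr0 : r ≠ 0 := by linarith
      congr 2
      · field_simp
      · congr 1; field_simp
    have e2 : ∫⁻ t in Ioi (0 : ℝ), (‖propagator t n‖ₑ ^ (2 / r) *
        ENNReal.ofReal ((1 + t) ^ (-(σ / r)))) ^ r =
        ∫⁻ t in Ioi (0 : ℝ), ‖propagator t n‖ₑ ^ 2 * ENNReal.ofReal ((1 + t) ^ (-σ)) := by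
      refine setLIntegral_congr_fun measurableSet_Ioi fun t ht => ?_
      have ht' : (0 : ℝ) < 1 + t := by have : (0 : ℝ) < t := ht; linarith
      have hr0 : r ≠ 0 := by linarith
      rw [ENNReal.mul_rpow_of_nonneg _ _ (by linarith), ← ENNReal.rpow_mul,
        ENNReal.ofReal_rpow_of_nonneg (by positivity) (by linarith), ← Real.rpow_mul ht'.le,
        ← ENNReal.rpow_natCast]
      congr 2
      · field_simp; norm_num
      · congr 1; field_simp
    rw [e0, e2] at hold
    have h5 := ENNReal.rpow_le_rpow (hold.trans (mul_le_mul_left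
      (ENNReal.rpow_le_rpow e1 (by rw [one_div]; exact hpq.inv_nonneg)) _)) (by linarith : 0 ≤ r)
    refine h5.trans_eq ?_
    have hr0 : r ≠ 0 := by linarith
    rw [ENNReal.mul_rpow_of_nonneg _ _ (by linarith), ← ENNReal.rpow_mul, ← ENNReal.rpow_mul,
      one_div_mul_cancel hr0, ENNReal.rpow_one]
    congr 2
    field_simp
  calc ∑' n : Lattice d, (∫⁻ t in Ioi (0 : ℝ), ‖propagator t n‖ₑ) ^ r
      ≤ ∑' n : Lattice d, C ^ (r - 1) * ∫⁻ t in Ioi (0 : ℝ),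
          ‖propagator t n‖ₑ ^ 2 * ENNReal.ofReal ((1 + t) ^ (-σ)) := ENNReal.tsum_le_tsum hkey
    _ = C ^ (r - 1) * ∫⁻ t in Ioi (0 : ℝ), ∑' n : Lattice d,
          ‖propagator t n‖ₑ ^ 2 * ENNReal.ofReal ((1 + t) ^ (-σ)) := by
        rw [ENNReal.tsum_mul_left, lintegral_tsum]
        exact fun n => (((hmk n).pow_const 2).mul (hmw _)).aemeasurable
    _ = C ^ (r - 1) * W := by
        simp_rw [ENNReal.tsum_mul_right, tsum_enorm_sq_propagator, one_mul, hW]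
    _ < ∞ := ENNReal.mul_lt_top (ENNReal.rpow_lt_top_of_nonneg hr1.le hC) hWfin

end Propagator

section FreeResolvent

open Set Real UnitAddTorus

variable {d : ℕ}

theorem inner_translate (a : Lattice d) (f g : L2 d) :
    inner ℂ (translate a f) g = inner ℂ f (translate (-a) g) := by
  rw [lp.inner_eq_tsum, lp.inner_eq_tsum,
    ← (Equiv.addRight a).tsum_eq (fun n => inner ℂ (f n) (translate (-a) g n))]
  refine tsum_congr fun n => ?_
  simp [translate_apply]

theorem isSelfAdjoint_discreteLaplacian (d : ℕ) : IsSelfAdjoint (discreteLaplacian d) := by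
  rw [ContinuousLinearMap.isSelfAdjoint_iff_isSymmetric]
  intro f g
  simp only [discreteLaplacian, ContinuousLinearMap.coe_coe, smul_apply,
    sum_apply, add_apply, inner_smul_left,
    inner_smul_right, sum_inner, inner_sum, inner_add_left, inner_add_right, inner_translate,
    neg_neg]
  congr 1
  · simp [Complex.conj_ofNat]
  · exact Finset.sum_congr rfl fun j _ => add_comm _ _

theorem isSelfAdjoint_mulOp {u : Lattice d → ℝ} (hu : Memℓp (fun n => (u n : ℂ)) ∞) :
    IsSelfAdjoint (mulOp (fun n => (u n : ℂ))) := by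
  rw [ContinuousLinearMap.isSelfAdjoint_iff_isSymmetric]
  intro f g
  simp only [ContinuousLinearMap.coe_coe]
  rw [lp.inner_eq_tsum, lp.inner_eq_tsum]
  refine tsum_congr fun n => ?_
  rw [mulOp_apply hu, mulOp_apply hu]
  simp only [RCLike.inner_apply, map_mul, Complex.conj_ofReal]
  ring

theorem isUnit_sub_algebraMap {T : L2 d →L[ℂ] L2 d} {z : ℂ} (hz : z ∉ spectrum ℂ T) :
    IsUnit (T - algebraMap ℂ (L2 d →L[ℂ] L2 d) z) := by
  rw [← neg_sub]
  exact (spectrum.notMem_iff.1 hz).neg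

theorem notMem_spectrum_of_im_pos {T : L2 d →L[ℂ] L2 d} (hT : IsSelfAdjoint T) {z : ℂ}
    (hz : 0 < z.im) : z ∉ spectrum ℂ T := fun h => by
  have := congrArg Complex.im (hT.mem_spectrum_eq_re h)
  simp at this
  linarith

theorem integrable_torus (h : C(UnitAddTorus (Fin d), ℂ)) : Integrable h (torusMeasure d) :=
  h.continuous.integrable_of_hasCompactSupport (HasCompactSupport.of_compactSpace _)

/-- The symbol as a complex-valued continuous map. -/
def symbolC (d : ℕ) : C(UnitAddTorus (Fin d), ℂ) where
  toFun x := (symbol d x : ℂ)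
  continuous_toFun := Complex.continuous_ofReal.comp (continuous_symbol d)

theorem mFourier_neg_add_single (n : Lattice d) (j : Fin d) (x : UnitAddTorus (Fin d)) :
    mFourier (-(n + Pi.single j 1)) x + mFourier (-(n + -Pi.single j 1)) x =
      mFourier (-n) x * (2 * ((fourier 1 (x j) : ℂ).re : ℂ)) := by
  rw [neg_add, neg_add, neg_neg, mFourier_add, mFourier_add, mFourier_neg (n := Pi.single j 1),
    mFourier_single, ← mul_add, add_comm, Complex.add_conj,
    Complex.ofReal_mul, Complex.ofReal_ofNat]

theorem discreteLaplacian_fourierSeq (h : C(UnitAddTorus (Fin d), ℂ)) :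
    discreteLaplacian d (fourierSeq h) = fourierSeq (symbolC d * h) := by
  apply lp.ext
  funext n
  have h1 : discreteLaplacian d (fourierSeq h) n =
      (1 / 2 : ℂ) * ∑ j : Fin d, (fourierSeq h (n + Pi.single j 1) +
        fourierSeq h (n + -Pi.single j 1)) := by
    simp only [discreteLaplacian, smul_apply, sum_apply,
      add_apply, lp.coeFn_smul, Pi.smul_apply, lp.coeFn_sum, Finset.sum_apply,
      lp.coeFn_add, Pi.add_apply, translate_apply, smul_eq_mul]
  rw [h1, fourierSeq_apply]
  have h2 : ∀ j : Fin d, fourierSeq h (n + Pi.single j 1) + fourierSeq h (n + -Pi.single j 1) =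
      ∫ x, mFourier (-n) x * (2 * ((fourier 1 (x j) : ℂ).re : ℂ)) * h x ∂torusMeasure d := by
    intro j
    have hi : ∀ k : Lattice d, Integrable (fun x => mFourier k x * h x) (torusMeasure d) :=
      fun k => integrable_torus (mFourier k * h)
    rw [fourierSeq_apply, fourierSeq_apply, ← integral_add (hi _) (hi _)]
    refine integral_congr_ae (Eventually.of_forall fun x => ?_)
    simp only
    rw [← mFourier_neg_add_single]; ring
  simp_rw [h2]
  rw [← integral_finsetSum, ← integral_const_mul]
  · refine integral_congr_ae (Eventually.of_forall fun x => ?_)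
    simp only [ContinuousMap.mul_apply, symbolC, ContinuousMap.coe_mk, symbol, Complex.ofReal_sum,
      Finset.mul_sum, Finset.sum_mul]
    exact Finset.sum_congr rfl fun j _ => by ring
  · intro j _
    exact integrable_torus ⟨fun x => mFourier (-n) x * (2 * ((fourier 1 (x j) : ℂ).re : ℂ)) * h x,
      by fun_prop⟩

theorem fourierSeq_mFourier (n : Lattice d) : fourierSeq (mFourier n) = lp.single 2 n (1 : ℂ) := by
  have h1 := (mFourierBasis (d := Fin d)).repr_self n
  rw [coe_mFourierBasis] at h1
  exact h1

/-- The symbol of the free resolvent. -/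
def resolventSymbol (d : ℕ) {z : ℂ} (hz : 0 < z.im) : C(UnitAddTorus (Fin d), ℂ) where
  toFun x := ((symbol d x : ℂ) - z)⁻¹
  continuous_toFun := by
    refine Continuous.inv₀ (by have := continuous_symbol d; fun_prop) fun x h => ?_
    have := congrArg Complex.im h
    simp at this
    linarith

theorem symbol_sub_ne_zero {z : ℂ} (hz : 0 < z.im) (s : ℝ) : (s : ℂ) - z ≠ 0 := fun h => by
  have := congrArg Complex.im h
  simp at this
  linarith

theorem freeResolvent_single {z : ℂ} (hz : 0 < z.im) (n : Lattice d) :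
    freeResolvent d z (lp.single 2 n (1 : ℂ)) = fourierSeq (mFourier n * resolventSymbol d hz) := by
  have hu := isUnit_sub_algebraMap
    (notMem_spectrum_of_im_pos (isSelfAdjoint_discreteLaplacian d) hz)
  have h1 : (discreteLaplacian d - algebraMap ℂ (L2 d →L[ℂ] L2 d) z)
      (fourierSeq (mFourier n * resolventSymbol d hz)) = lp.single 2 n (1 : ℂ) := by
    rw [← fourierSeq_mFourier, sub_apply, discreteLaplacian_fourierSeq,
      ContinuousLinearMap.algebraMap_apply]
    have hi : ∀ (k : Lattice d) (h : C(UnitAddTorus (Fin d), ℂ)),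
        Integrable (fun x => mFourier k x * h x) (torusMeasure d) :=
      fun k h => integrable_torus (mFourier k * h)
    apply lp.ext
    funext m
    rw [lp.coeFn_sub, Pi.sub_apply, lp.coeFn_smul, Pi.smul_apply, smul_eq_mul, fourierSeq_apply,
      fourierSeq_apply, fourierSeq_apply, ← integral_const_mul, ← integral_sub
      (hi _ _) ((hi _ _).const_mul z)]
    refine integral_congr_ae (Eventually.of_forall fun x => ?_)
    simp only [ContinuousMap.mul_apply, symbolC, resolventSymbol, ContinuousMap.coe_mk]
    have := symbol_sub_ne_zero hz (symbol d x)
    field_simp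
  rw [← h1, freeResolvent, ← mul_apply_eq_comp, Ring.inverse_mul_cancel _ hu,
    one_apply_eq_self]

/-- The kernel of the free resolvent, including its boundary values on the real axis. -/
def greenKernel (z : ℂ) (n : Lattice d) : ℂ :=
  Complex.I * ∫ t in Ioi (0 : ℝ), Complex.exp (Complex.I * z * t) * propagator t n

theorem norm_exp_I_mul_mul (z : ℂ) (t : ℝ) :
    ‖Complex.exp (Complex.I * z * t)‖ = Real.exp (-z.im * t) := by
  rw [Complex.norm_exp]; simp

theorem freeResolvent_single_apply {z : ℂ} (hz : 0 < z.im) (n m : Lattice d) :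
    freeResolvent d z (lp.single 2 n (1 : ℂ)) m = greenKernel z (n - m) := by
  rw [freeResolvent_single hz, fourierSeq_apply, greenKernel]
  have h0 : ∀ t : ℝ, Complex.exp (Complex.I * z * t) * propagator t (n - m) =
      ∫ x, Complex.exp (Complex.I * z * t) * (mFourier (n - m) x *
        Complex.exp (-(Complex.I * t * (symbol d x : ℂ)))) ∂torusMeasure d := fun t => by
    rw [propagator_eq_integral, integral_const_mul]
  simp_rw [h0]
  rw [integral_integral_swap]
  · rw [← integral_const_mul]
    refine integral_congr_ae (Eventually.of_forall fun x => ?_)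
    simp only [ContinuousMap.mul_apply, resolventSymbol, ContinuousMap.coe_mk]
    have hne := symbol_sub_ne_zero hz (symbol d x)
    have hexp : ∀ t : ℝ, Complex.exp (Complex.I * z * t) * (mFourier (n - m) x *
        Complex.exp (-(Complex.I * t * (symbol d x : ℂ)))) =
        mFourier (n - m) x * Complex.exp (Complex.I * (z - symbol d x) * t) := fun t => by
      rw [mul_left_comm, ← Complex.exp_add]; ring_nf
    simp_rw [hexp]
    rw [integral_const_mul, integral_exp_mul_complex_Ioi (by simpa using hz), sub_eq_neg_add n m,
      mFourier_add]
    have hI := Complex.I_ne_zero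
    have hne' : z - (symbol d x : ℂ) ≠ 0 := fun h => hne (by linear_combination -h)
    simp
    field_simp
    ring
  · have h1 : Integrable (fun t : ℝ => Real.exp (-z.im * t)) (volume.restrict (Ioi (0 : ℝ))) :=
      integrableOn_exp_mul_Ioi (by linarith) 0
    refine (h1.comp_fst (torusMeasure d)).mono' ?_ (Eventually.of_forall fun x => ?_)
    · have := continuous_symbol d
      exact Continuous.aestronglyMeasurable (by simp only [Function.uncurry_def]; fun_prop)
    · simp only [Function.uncurry_def]
      rw [norm_mul, norm_mul, norm_exp_I_mul_mul, norm_mFourier_apply, norm_exp_neg_I_mul,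
        mul_one, mul_one]

/-- The time-integrated modulus of the propagator, which dominates the kernel of the resolvent. -/
def greenMajorant (n : Lattice d) : ℝ := (∫⁻ t in Ioi (0 : ℝ), ‖propagator t n‖ₑ).toReal

theorem lintegral_propagator_lt_top (hd : 3 ≤ d) (n : Lattice d) :
    ∫⁻ t in Ioi (0 : ℝ), ‖propagator t n‖ₑ < ∞ := by
  have h := ENNReal.ne_top_of_tsum_ne_top
    (tsum_lintegral_propagator_rpow_lt_top hd (lt_add_one _)).ne n
  have hd3 : (3 : ℝ) ≤ d := by exact_mod_cast hd
  have hpos : 0 < 2 * (d : ℝ) / (d - 2) + 1 := by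
    have : 0 < (d : ℝ) - 2 := by linarith
    positivity
  exact (ENNReal.rpow_lt_top_iff_of_pos hpos).1 h.lt_top

theorem integrableOn_propagator (hd : 3 ≤ d) (n : Lattice d) :
    IntegrableOn (fun t => propagator t n) (Ioi (0 : ℝ)) :=
  ⟨(continuous_propagator n).aestronglyMeasurable, lintegral_propagator_lt_top hd n⟩

theorem summable_greenMajorant_rpow (hd : 3 ≤ d) {r : ℝ} (hr : 2 * (d : ℝ) / (d - 2) < r) :
    Summable fun n : Lattice d => greenMajorant n ^ r := by
  have h := ENNReal.summable_toReal (tsum_lintegral_propagator_rpow_lt_top hd hr).ne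
  simpa only [greenMajorant, ENNReal.toReal_rpow] using h

theorem norm_greenKernel_integrand_le {z : ℂ} (hz : 0 ≤ z.im) (n : Lattice d) {t : ℝ}
    (ht : t ∈ Ioi (0 : ℝ)) :
    ‖Complex.exp (Complex.I * z * t) * propagator t n‖ ≤ ‖propagator t n‖ := by
  rw [norm_mul, norm_exp_I_mul_mul]
  have ht' : 0 < t := ht
  exact mul_le_of_le_one_left (norm_nonneg _) (Real.exp_le_one_iff.2 (by nlinarith))

theorem norm_greenKernel_le (hd : 3 ≤ d) {z : ℂ} (hz : 0 ≤ z.im) (n : Lattice d) :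
    ‖greenKernel z n‖ ≤ greenMajorant n := by
  rw [greenKernel, norm_mul, Complex.norm_I, one_mul]
  refine (norm_integral_le_integral_norm _).trans ?_
  have h1 : ∫ t in Ioi (0 : ℝ), ‖propagator t n‖ = greenMajorant n := by
    rw [integral_norm_eq_lintegral_enorm (continuous_propagator n).aestronglyMeasurable]
    rfl
  rw [← h1]
  refine integral_mono_of_nonneg (Eventually.of_forall fun t => norm_nonneg _)
    (integrableOn_propagator hd n).norm ?_
  filter_upwards [ae_restrict_mem measurableSet_Ioi] with t ht
  exact norm_greenKernel_integrand_le hz n ht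

theorem continuousOn_greenKernel (hd : 3 ≤ d) (n : Lattice d) :
    ContinuousOn (fun z : ℂ => greenKernel z n) {z | 0 ≤ z.im} := by
  refine continuousOn_const.mul (continuousOn_of_dominated (bound := fun t => ‖propagator t n‖)
    (fun z _ => ?_) (fun z hz => ?_) (integrableOn_propagator hd n).norm ?_)
  · have := continuous_propagator n
    exact Continuous.aestronglyMeasurable (by fun_prop)
  · filter_upwards [ae_restrict_mem measurableSet_Ioi] with t ht
    exact norm_greenKernel_integrand_le hz n ht
  · exact Eventually.of_forall fun t => Continuous.continuousOn (by fun_prop)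

end FreeResolvent

section HilbertSchmidt

variable {d : ℕ}

theorem hasSum_norm_sq (f : L2 d) : HasSum (fun n => ‖f n‖ ^ 2) (‖f‖ ^ 2) := by
  have := lp.hasSum_norm (p := 2) (by norm_num) f
  simpa using this

/-- The operator norm is bounded by the Hilbert–Schmidt norm. -/
theorem opNorm_sq_le_tsum {T : L2 d →L[ℂ] L2 d}
    (hs : Summable fun x : Lattice d × Lattice d => ‖T (lp.single 2 x.1 (1 : ℂ)) x.2‖ ^ 2) :
    ‖T‖ ^ 2 ≤ ∑' x : Lattice d × Lattice d, ‖T (lp.single 2 x.1 (1 : ℂ)) x.2‖ ^ 2 := by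
  set B := ∑' x : Lattice d × Lattice d, ‖T (lp.single 2 x.1 (1 : ℂ)) x.2‖ ^ 2 with hB
  have hB0 : 0 ≤ B := tsum_nonneg fun x => by positivity
  have hcol : ∀ n : Lattice d, ∑' m, ‖T (lp.single 2 n (1 : ℂ)) m‖ ^ 2 =
      ‖T (lp.single 2 n (1 : ℂ))‖ ^ 2 := fun n => (hasSum_norm_sq _).tsum_eq
  have hcols : ∀ s : Finset (Lattice d), ∑ n ∈ s, ‖T (lp.single 2 n (1 : ℂ))‖ ^ 2 ≤ B := by
    intro s
    have h1 := hs.prod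
    simp only [hcol] at h1
    have h2 := hs.tsum_prod
    simp only [hcol] at h2
    rw [hB, h2]
    exact h1.sum_le_tsum s fun n _ => by positivity
  have hT : ‖T‖ ≤ √B := by
    refine T.opNorm_le_bound (Real.sqrt_nonneg _) fun f => ?_
    have h1 := (lp.hasSum_single (p := 2) (by norm_num) f).mapL T
    refine le_of_tendsto h1.norm (Eventually.of_forall fun s => ?_)
    calc ‖∑ n ∈ s, T (lp.single 2 n (f n))‖
        ≤ ∑ n ∈ s, ‖T (lp.single 2 n (1 : ℂ))‖ * ‖f n‖ := by
          refine (norm_sum_le _ _).trans (Finset.sum_le_sum fun n _ => le_of_eq ?_)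
          rw [← mul_one (f n), ← smul_eq_mul, lp.single_smul, map_smul, norm_smul, mul_comm]
          simp
      _ ≤ √(∑ n ∈ s, ‖T (lp.single 2 n (1 : ℂ))‖ ^ 2) * √(∑ n ∈ s, ‖f n‖ ^ 2) :=
          Real.sum_mul_le_sqrt_mul_sqrt _ _ _
      _ ≤ √B * ‖f‖ := by
          gcongr
          · exact hcols s
          · rw [Real.sqrt_le_left (norm_nonneg _)]
            exact sum_le_hasSum s (fun n _ => by positivity) (hasSum_norm_sq f)
  calc ‖T‖ ^ 2 ≤ √B ^ 2 := by gcongr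
    _ = B := Real.sq_sqrt hB0

theorem opNorm_sq_le_of_le {T : L2 d →L[ℂ] L2 d} {G : Lattice d × Lattice d → ℝ}
    (hG : Summable G) (h : ∀ n m, ‖T (lp.single 2 n (1 : ℂ)) m‖ ^ 2 ≤ G (n, m)) :
    ‖T‖ ^ 2 ≤ ∑' x, G x := by
  have hs : Summable fun x : Lattice d × Lattice d => ‖T (lp.single 2 x.1 (1 : ℂ)) x.2‖ ^ 2 :=
    hG.of_nonneg_of_le (fun x => by positivity) (fun x => h x.1 x.2)
  exact (opNorm_sq_le_tsum hs).trans (hs.tsum_le_tsum (fun x => h x.1 x.2) hG)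

end HilbertSchmidt

section Majorant

variable {d : ℕ}

/-- The square of the dominating Hilbert–Schmidt kernel of `q₁ R₀(z) q₂`. -/
def hsMajorant (V : Lattice d → ℝ) (q₂ : Lattice d → ℂ) (x : Lattice d × Lattice d) : ℝ :=
  |V x.2| * greenMajorant (x.1 - x.2) ^ 2 * ‖q₂ x.1‖ ^ 2

theorem greenMajorant_nonneg (n : Lattice d) : 0 ≤ greenMajorant n := ENNReal.toReal_nonneg

theorem hsMajorant_nonneg (V : Lattice d → ℝ) (q₂ : Lattice d → ℂ) (x : Lattice d × Lattice d) :
    0 ≤ hsMajorant V q₂ x := by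
  unfold hsMajorant; positivity

theorem summable_hsMajorant (hd : 3 ≤ d) {p : ℝ} (hp1 : 1 < p) (hp : p < 2 * (d : ℝ) / (d + 2))
    {V : Lattice d → ℝ} (hV : Summable fun n => |V n| ^ p) {q₂ : Lattice d → ℂ}
    (hq₂ : Summable fun n => ‖q₂ n‖ ^ (2 * p)) : Summable (hsMajorant V q₂) := by
  have hd3 : (3 : ℝ) ≤ d := by exact_mod_cast hd
  have hpd : p * (d + 2) < 2 * d := (lt_div_iff₀ (by linarith)).1 hp
  have hp0 : 0 < p := by linarith
  have hp2 : p ≤ 2 := by nlinarith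
  set r := p / (p - 1) with hr
  have hr0 : 0 < r := div_pos hp0 (by linarith)
  have hrd : 2 * (d : ℝ) / (d - 2) < r := by
    rw [hr, div_lt_div_iff₀ (by linarith) (by linarith)]; nlinarith
  have hg := summable_greenMajorant_rpow hd hrd
  have hb : 1 / r = 1 - 1 / p := by rw [hr]; field_simp
  have hab : Summable fun x : Lattice d × Lattice d => ‖q₂ x.1‖ ^ (2 * p) * |V x.2| ^ p :=
    hq₂.mul_of_nonneg hV (fun n => by positivity) (fun n => by positivity)
  have e1 : Function.Injective fun x : Lattice d × Lattice d => (x.1, x.1 - x.2) := by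
    rintro ⟨a, b⟩ ⟨a', b'⟩ h
    simp only [Prod.mk.injEq] at h ⊢
    exact ⟨h.1, sub_right_inj.1 (h.1 ▸ h.2)⟩
  have e2 : Function.Injective fun x : Lattice d × Lattice d => (x.2, x.1 - x.2) := by
    rintro ⟨a, b⟩ ⟨a', b'⟩ h
    simp only [Prod.mk.injEq] at h ⊢
    exact ⟨sub_left_inj.1 (h.1 ▸ h.2), h.1⟩
  have hbk : Summable fun x : Lattice d × Lattice d =>
      ‖q₂ x.1‖ ^ (2 * p) * greenMajorant (x.1 - x.2) ^ r := by
    have := hq₂.mul_of_nonneg hg (fun n => by positivity)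
      (fun n => Real.rpow_nonneg (greenMajorant_nonneg n) _)
    simpa only [Function.comp_def] using this.comp_injective e1
  have hak : Summable fun x : Lattice d × Lattice d =>
      |V x.2| ^ p * greenMajorant (x.1 - x.2) ^ r := by
    have := hV.mul_of_nonneg hg (fun n => by positivity)
      (fun n => Real.rpow_nonneg (greenMajorant_nonneg n) _)
    simpa only [Function.comp_def] using this.comp_injective e2
  refine Summable.of_nonneg_of_le (hsMajorant_nonneg V q₂) (fun x => ?_)
    (((hab.mul_left (2 / p - 1)).add (hak.mul_left (1 / r))).add (hbk.mul_left (1 / r)))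
  have hk0 := greenMajorant_nonneg (x.1 - x.2)
  have hw : 0 ≤ 2 / p - 1 := by
    rw [sub_nonneg, le_div_iff₀ hp0]; linarith
  have key := Real.geom_mean_le_arith_mean3_weighted (w₁ := 2 / p - 1) (w₂ := 1 / r) (w₃ := 1 / r)
    (p₁ := ‖q₂ x.1‖ ^ (2 * p) * |V x.2| ^ p) (p₂ := |V x.2| ^ p * greenMajorant (x.1 - x.2) ^ r)
    (p₃ := ‖q₂ x.1‖ ^ (2 * p) * greenMajorant (x.1 - x.2) ^ r)
    hw (by positivity) (by positivity) (by positivity) (by positivity) (by positivity)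
    (by rw [hb]; ring)
  refine le_trans (le_of_eq ?_) key
  rw [Real.mul_rpow (by positivity) (by positivity), Real.mul_rpow (by positivity) (by positivity),
    Real.mul_rpow (by positivity) (by positivity)]
  have hk : ∀ y : ℝ, 0 ≤ y → (y ^ p) ^ (2 / p - 1) * (y ^ p) ^ (1 / r) = y := fun y hy => by
    rw [← Real.rpow_add_of_nonneg (by positivity) hw (by positivity), ← Real.rpow_mul hy, hb]
    rw [show p * (2 / p - 1 + (1 - 1 / p)) = 1 by field_simp; ring, Real.rpow_one]
  have hk2 : (‖q₂ x.1‖ ^ (2 * p)) ^ (2 / p - 1) * (‖q₂ x.1‖ ^ (2 * p)) ^ (1 / r) =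
      ‖q₂ x.1‖ ^ 2 := by
    rw [Real.rpow_mul (norm_nonneg _), hk _ (by positivity)]
    norm_cast
  have hk3 : (greenMajorant (x.1 - x.2) ^ r) ^ (1 / r) * (greenMajorant (x.1 - x.2) ^ r) ^ (1 / r)
      = greenMajorant (x.1 - x.2) ^ 2 := by
    rw [← Real.rpow_mul hk0, mul_one_div_cancel hr0.ne', Real.rpow_one, sq]
  unfold hsMajorant
  rw [← hk2, ← hk3]
  nth_rw 1 [← hk |V x.2| (abs_nonneg _)]
  ring

end Majorant

section Sandwiched

variable {d : ℕ} {V : Lattice d → ℝ} {q₂ : Lattice d → ℂ}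

theorem norm_sqrtAbs_sq (V : Lattice d → ℝ) (n : Lattice d) : ‖sqrtAbs V n‖ ^ 2 = |V n| := by
  rw [sqrtAbs, Complex.norm_real, Real.norm_of_nonneg (Real.sqrt_nonneg _),
    Real.sq_sqrt (abs_nonneg _)]

theorem sandwichedResolvent_single_apply (h1 : Memℓp (sqrtAbs V) ∞) (h2 : Memℓp q₂ ∞) {z : ℂ}
    (hz : 0 < z.im) (n m : Lattice d) :
    sandwichedResolvent V q₂ z (lp.single 2 n (1 : ℂ)) m =
      sqrtAbs V m * greenKernel z (n - m) * q₂ n := by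
  have h3 : mulOp q₂ (lp.single 2 n (1 : ℂ)) = q₂ n • (lp.single 2 n (1 : ℂ) : L2 d) := by
    apply lp.ext
    funext k
    rw [mulOp_apply h2, lp.coeFn_smul, Pi.smul_apply, smul_eq_mul]
    rcases eq_or_ne k n with rfl | hk
    · rfl
    · rw [lp.single_apply_ne _ _ _ hk, mul_zero, mul_zero]
  rw [sandwichedResolvent, ContinuousLinearMap.comp_apply, ContinuousLinearMap.comp_apply, h3,
    mulOp_apply h1, map_smul, lp.coeFn_smul, Pi.smul_apply, freeResolvent_single_apply hz,
    smul_eq_mul]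
  ring

theorem norm_sq_sandwichedResolvent_sub_le (hd : 3 ≤ d) (h1 : Memℓp (sqrtAbs V) ∞)
    (h2 : Memℓp q₂ ∞) (hG : Summable (hsMajorant V q₂)) {z w : ℂ} (hz : 0 < z.im) (hw : 0 < w.im) :
    ‖sandwichedResolvent V q₂ z - sandwichedResolvent V q₂ w‖ ^ 2 ≤
      ∑' x : Lattice d × Lattice d, |V x.2| *
        ‖greenKernel z (x.1 - x.2) - greenKernel w (x.1 - x.2)‖ ^ 2 * ‖q₂ x.1‖ ^ 2 := by
  refine opNorm_sq_le_of_le (Summable.of_nonneg_of_le (fun x => by positivity) (fun x => ?_)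
    (hG.mul_left 4)) (fun n m => le_of_eq ?_)
  · have h3 : ‖greenKernel z (x.1 - x.2) - greenKernel w (x.1 - x.2)‖ ≤
        2 * greenMajorant (x.1 - x.2) :=
      (norm_sub_le _ _).trans (by
        linarith [norm_greenKernel_le hd hz.le (x.1 - x.2),
          norm_greenKernel_le hd hw.le (x.1 - x.2)])
    calc _ ≤ |V x.2| * (2 * greenMajorant (x.1 - x.2)) ^ 2 * ‖q₂ x.1‖ ^ 2 := by gcongr
      _ = 4 * hsMajorant V q₂ x := by unfold hsMajorant; ring
  · rw [sub_apply, lp.coeFn_sub, Pi.sub_apply,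
      sandwichedResolvent_single_apply h1 h2 hz, sandwichedResolvent_single_apply h1 h2 hw,
      ← sub_mul, ← mul_sub, norm_mul, norm_mul, mul_pow, mul_pow, norm_sqrtAbs_sq]

theorem nhdsWithin_upperHalf_neBot {x : ℂ} (hx : 0 ≤ x.im) : (𝓝[{z : ℂ | 0 < z.im}] x).NeBot := by
  rw [← mem_closure_iff_nhdsWithin_neBot, Complex.closure_setOfPred_lt_im]
  exact hx

/-- The limiting absorption principle for `q₁ R₀(z) q₂`. -/
theorem exists_tendsto_sandwichedResolvent (hd : 3 ≤ d) (h1 : Memℓp (sqrtAbs V) ∞)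
    (h2 : Memℓp q₂ ∞) (hG : Summable (hsMajorant V q₂)) {x : ℂ} (hx : 0 ≤ x.im) :
    ∃ T, Tendsto (sandwichedResolvent V q₂) (𝓝[{z : ℂ | 0 < z.im}] x) (𝓝 T) := by
  have hne := nhdsWithin_upperHalf_neBot hx
  rw [← cauchy_map_iff_exists_tendsto, cauchy_map_iff]
  refine ⟨hne, tendsto_uniformity_iff_dist_tendsto_zero.2 ?_⟩
  set l := 𝓝[{z : ℂ | 0 < z.im}] x
  have hmem : ∀ᶠ y : ℂ × ℂ in l ×ˢ l, 0 < y.1.im ∧ 0 < y.2.im :=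
    (eventually_mem_nhdsWithin).prod_mk (eventually_mem_nhdsWithin)
  have hk : ∀ n : Lattice d, Tendsto (fun z => greenKernel z n) l (𝓝 (greenKernel x n)) := fun n =>
    ((continuousOn_greenKernel hd n) x hx).mono_left
      (nhdsWithin_mono x fun z (hz : 0 < z.im) => hz.le)
  have hlim : Tendsto (fun y : ℂ × ℂ => ∑' x : Lattice d × Lattice d, |V x.2| *
        ‖greenKernel y.1 (x.1 - x.2) - greenKernel y.2 (x.1 - x.2)‖ ^ 2 * ‖q₂ x.1‖ ^ 2)
      (l ×ˢ l) (𝓝 (∑' _ : Lattice d × Lattice d, 0)) := by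
    refine tendsto_tsum_of_dominated_convergence (bound := fun x => 4 * hsMajorant V q₂ x)
      (hG.mul_left 4) (fun u => ?_) ?_
    · have h3 := ((hk (u.1 - u.2)).comp tendsto_fst).sub ((hk (u.1 - u.2)).comp
        (tendsto_snd (f := l) (g := l)))
      rw [sub_self] at h3
      simpa using ((h3.norm.pow 2).const_mul |V u.2|).mul_const (‖q₂ u.1‖ ^ 2)
    · filter_upwards [hmem] with y hy u
      have h3 : ‖greenKernel y.1 (u.1 - u.2) - greenKernel y.2 (u.1 - u.2)‖ ≤
          2 * greenMajorant (u.1 - u.2) :=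
        (norm_sub_le _ _).trans (by
          linarith [norm_greenKernel_le hd hy.1.le (u.1 - u.2),
            norm_greenKernel_le hd hy.2.le (u.1 - u.2)])
      rw [Real.norm_of_nonneg (by positivity)]
      calc _ ≤ |V u.2| * (2 * greenMajorant (u.1 - u.2)) ^ 2 * ‖q₂ u.1‖ ^ 2 := by gcongr
        _ = 4 * hsMajorant V q₂ u := by unfold hsMajorant; ring
  rw [tsum_zero] at hlim
  have hsq : Tendsto (fun y : ℂ × ℂ =>
      dist (sandwichedResolvent V q₂ y.1) (sandwichedResolvent V q₂ y.2) ^ 2) (l ×ˢ l) (𝓝 0) := by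
    refine tendsto_of_tendsto_of_tendsto_of_le_of_le' tendsto_const_nhds hlim
      (Eventually.of_forall fun y => by positivity) ?_
    filter_upwards [hmem] with y hy
    rw [dist_eq_norm]
    exact norm_sq_sandwichedResolvent_sub_le hd h1 h2 hG hy.1 hy.2
  have := hsq.sqrt
  simpa [Real.sqrt_sq dist_nonneg] using this

/-- The continuous extension of `q₁ R₀(z) q₂` to the closed upper half-plane. -/
def extendedResolvent (V : Lattice d → ℝ) (q₂ : Lattice d → ℂ) : ℂ → L2 d →L[ℂ] L2 d :=
  extendFrom {z : ℂ | 0 < z.im} (sandwichedResolvent V q₂)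

theorem boundaryResolvent_eq (x : ℝ) :
    boundaryResolvent V q₂ x = extendedResolvent V q₂ (x : ℂ) := rfl

theorem tendsto_extendedResolvent (hd : 3 ≤ d) (h1 : Memℓp (sqrtAbs V) ∞)
    (h2 : Memℓp q₂ ∞) (hG : Summable (hsMajorant V q₂)) {x : ℂ} (hx : 0 ≤ x.im) :
    Tendsto (sandwichedResolvent V q₂) (𝓝[{z : ℂ | 0 < z.im}] x)
      (𝓝 (extendedResolvent V q₂ x)) :=
  tendsto_extendFrom (exists_tendsto_sandwichedResolvent hd h1 h2 hG hx)

theorem continuousOn_extendedResolvent (hd : 3 ≤ d) (h1 : Memℓp (sqrtAbs V) ∞)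
    (h2 : Memℓp q₂ ∞) (hG : Summable (hsMajorant V q₂)) :
    ContinuousOn (extendedResolvent V q₂) {z | 0 ≤ z.im} :=
  continuousOn_extendFrom (by rw [Complex.closure_setOfPred_lt_im])
    fun _ hx => exists_tendsto_sandwichedResolvent hd h1 h2 hG hx

theorem differentiableAt_ringInverse_sub {T : L2 d →L[ℂ] L2 d} {z : ℂ} (hz : z ∉ spectrum ℂ T) :
    DifferentiableAt ℂ
      (fun z => Ring.inverse (T - algebraMap ℂ (L2 d →L[ℂ] L2 d) z)) z := by
  have h1 := differentiableAt_inverse (𝕜 := ℂ) (isUnit_sub_algebraMap hz)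
  have h2 : DifferentiableAt ℂ (fun z => T - algebraMap ℂ (L2 d →L[ℂ] L2 d) z) z := by
    simp only [Algebra.algebraMap_eq_smul_one]
    exact (differentiableAt_const T).sub (differentiableAt_id.smul_const 1)
  exact DifferentiableAt.comp z h1 h2

theorem differentiableAt_sandwichedResolvent {z : ℂ} (hz : 0 < z.im) :
    DifferentiableAt ℂ (sandwichedResolvent V q₂) z := by
  have h := differentiableAt_ringInverse_sub
    (notMem_spectrum_of_im_pos (isSelfAdjoint_discreteLaplacian d) hz)
  exact (h.mul_const (mulOp q₂)).const_mul (mulOp (sqrtAbs V))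

theorem extendedResolvent_eq {z : ℂ} (hz : 0 < z.im) :
    extendedResolvent V q₂ z = sandwichedResolvent V q₂ z := by
  have := nhdsWithin_upperHalf_neBot hz.le
  exact extendFrom_eq (by rw [Complex.closure_setOfPred_lt_im]; exact hz.le)
    ((differentiableAt_sandwichedResolvent hz).continuousAt.tendsto.mono_left nhdsWithin_le_nhds)

theorem norm_le_of_forall_sandwichedResolvent (hd : 3 ≤ d) (h1 : Memℓp (sqrtAbs V) ∞)
    (h2 : Memℓp q₂ ∞) (hG : Summable (hsMajorant V q₂)) {B : L2 d →L[ℂ] L2 d} {C : ℝ}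
    (h : ∀ z : ℂ, 0 < z.im → ‖B * sandwichedResolvent V q₂ z‖ ≤ C) {x : ℂ} (hx : 0 ≤ x.im) :
    ‖B * extendedResolvent V q₂ x‖ ≤ C := by
  have := nhdsWithin_upperHalf_neBot hx
  refine le_of_tendsto ((tendsto_extendedResolvent hd h1 h2 hG hx).const_mul B).norm ?_
  filter_upwards [self_mem_nhdsWithin] with z hz using h z hz

theorem norm_sq_sandwichedResolvent_single_le (hd : 3 ≤ d) (h1 : Memℓp (sqrtAbs V) ∞)
    (h2 : Memℓp q₂ ∞) {z : ℂ} (hz : 0 < z.im) (n m : Lattice d) :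
    ‖sandwichedResolvent V q₂ z (lp.single 2 n (1 : ℂ)) m‖ ^ 2 ≤ hsMajorant V q₂ (n, m) := by
  rw [sandwichedResolvent_single_apply h1 h2 hz, norm_mul, norm_mul, mul_pow, mul_pow,
    norm_sqrtAbs_sq, hsMajorant]
  gcongr
  exact norm_greenKernel_le hd hz.le _

theorem exists_norm_extendedResolvent_le (hd : 3 ≤ d) (h1 : Memℓp (sqrtAbs V) ∞)
    (h2 : Memℓp q₂ ∞) (hG : Summable (hsMajorant V q₂)) :
    ∃ C, ∀ z : ℂ, 0 ≤ z.im → ‖extendedResolvent V q₂ z‖ ≤ C := by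
  refine ⟨√(∑' x, hsMajorant V q₂ x), fun z hz => ?_⟩
  have := norm_le_of_forall_sandwichedResolvent hd h1 h2 hG (B := 1)
    (C := √(∑' x, hsMajorant V q₂ x)) (fun w hw => ?_) hz
  · rwa [one_mul] at this
  · rw [one_mul]
    exact Real.le_sqrt_of_sq_le (opNorm_sq_le_of_le hG
      (norm_sq_sandwichedResolvent_single_le hd h1 h2 hw))

/-- Multiplication by the indicator of the complement of a finite set. -/
def cutoff (S : Finset (Lattice d)) : L2 d →L[ℂ] L2 d :=
  mulOp fun n => if n ∈ S then 0 else 1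

theorem cutoff_apply (S : Finset (Lattice d)) (f : L2 d) (n : Lattice d) :
    cutoff S f n = if n ∈ S then 0 else f n := by
  rw [cutoff, mulOp_apply]
  · split_ifs <;> simp
  · refine memℓp_infty ⟨1, ?_⟩
    rintro _ ⟨n, rfl⟩
    simp only
    split_ifs <;> simp

/-- Outside a finite set the operators `q₁ R₀(z) q₂` are uniformly small. -/
theorem exists_norm_cutoff_mul_le (hd : 3 ≤ d) (h1 : Memℓp (sqrtAbs V) ∞)
    (h2 : Memℓp q₂ ∞) (hG : Summable (hsMajorant V q₂)) :
    ∃ S : Finset (Lattice d), ∀ z : ℂ, 0 ≤ z.im →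
      ‖cutoff S * extendedResolvent V q₂ z‖ ≤ 1 / 2 := by
  obtain ⟨s, hs⟩ := ((tendsto_tsum_compl_atTop_zero (hsMajorant V q₂)).eventually
    (gt_mem_nhds (show (0 : ℝ) < 1 / 4 by norm_num))).exists
  refine ⟨s.image Prod.snd, fun z hz => norm_le_of_forall_sandwichedResolvent hd h1 h2 hG
    (fun w hw => ?_) hz⟩
  have hind : Summable (Set.indicator {x | x ∉ s} (hsMajorant V q₂)) := hG.indicator _
  have h3 := opNorm_sq_le_of_le (T := cutoff (s.image Prod.snd) * sandwichedResolvent V q₂ w) hind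
    (fun n m => ?_)
  · rw [← tsum_subtype] at h3
    exact abs_le_of_sq_le_sq' (h3.trans (hs.le.trans (by norm_num))) (by norm_num) |>.2
  · rw [mul_apply_eq_comp, cutoff_apply]
    split_ifs with hm
    · simpa using Set.indicator_nonneg (fun x _ => hsMajorant_nonneg V q₂ x) _
    · have : (n, m) ∈ {x | x ∉ s} := fun h => hm (Finset.mem_image_of_mem Prod.snd h)
      rw [Set.indicator_of_mem this]
      exact norm_sq_sandwichedResolvent_single_le hd h1 h2 hw n m

end Sandwiched

section BoundaryUniqueness

open Set Real

/-- The Cayley transform from the unit disc to the upper half-plane. -/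
def cayley (w : ℂ) : ℂ := Complex.I * (1 + w) / (1 - w)

theorem cayley_im_pos {w : ℂ} (hw : ‖w‖ < 1) : 0 < (cayley w).im := by
  have h1 : (1 : ℂ) - w ≠ 0 := fun h => by
    rw [← sub_eq_zero.1 h, norm_one] at hw; exact lt_irrefl _ hw
  have h2 : 0 < Complex.normSq (1 - w) := Complex.normSq_pos.2 h1
  have h3 : w.re ^ 2 + w.im ^ 2 < 1 := by
    have h4 : Complex.normSq w < 1 := by
      rw [Complex.normSq_eq_norm_sq]
      nlinarith [norm_nonneg w]
    rw [Complex.normSq_apply] at h4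
    nlinarith
  have h5 : (cayley w).im = (1 - (w.re ^ 2 + w.im ^ 2)) / Complex.normSq (1 - w) := by
    rw [cayley, Complex.div_im]
    simp only [Complex.mul_re, Complex.mul_im, Complex.I_re, Complex.I_im, Complex.add_re,
      Complex.add_im, Complex.sub_re, Complex.sub_im, Complex.one_re, Complex.one_im]
    field_simp
    ring
  rw [h5]
  exact div_pos (by linarith) h2

theorem differentiableAt_cayley {w : ℂ} (hw : w ≠ 1) : DifferentiableAt ℂ cayley w := by
  unfold cayley
  exact DifferentiableAt.div (by fun_prop) (by fun_prop) (sub_ne_zero.2 hw.symm)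

/-- The boundary values of the Cayley transform. -/
def cayleyBoundary (θ : ℝ) : ℝ := -(cos (θ / 2) / sin (θ / 2))

theorem sin_half_pos {θ : ℝ} (hθ : θ ∈ Ioo 0 (2 * π)) : 0 < sin (θ / 2) :=
  sin_pos_of_pos_of_lt_pi (by linarith [hθ.1]) (by linarith [hθ.2])

theorem exp_ne_one {θ : ℝ} (hθ : θ ∈ Ioo 0 (2 * π)) : Complex.exp (θ * Complex.I) ≠ 1 := by
  intro h
  have h1 := congrArg Complex.re h
  rw [Complex.exp_ofReal_mul_I_re, Complex.one_re, show θ = 2 * (θ / 2) by ring,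
    Real.cos_two_mul'] at h1
  nlinarith [sin_half_pos hθ, Real.sin_sq_add_cos_sq (θ / 2)]

theorem cayley_exp {θ : ℝ} (hθ : θ ∈ Ioo 0 (2 * π)) :
    cayley (Complex.exp (θ * Complex.I)) = cayleyBoundary θ := by
  have hs : (Complex.sin ((θ / 2 : ℝ) : ℂ)) ≠ 0 := by
    rw [← Complex.ofReal_sin]; exact_mod_cast (sin_half_pos hθ).ne'
  have hne : (1 : ℂ) - Complex.exp (θ * Complex.I) ≠ 0 := sub_ne_zero.2 (exp_ne_one hθ).symm
  have h2 : Complex.exp (θ * Complex.I) =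
      (Complex.cos ((θ / 2 : ℝ) : ℂ) + Complex.sin ((θ / 2 : ℝ) : ℂ) * Complex.I) ^ 2 := by
    rw [← Complex.exp_mul_I, ← Complex.exp_nat_mul]
    congr 1; push_cast; ring
  have h3 := Complex.sin_sq_add_cos_sq ((θ / 2 : ℝ) : ℂ)
  rw [cayley, cayleyBoundary, div_eq_iff hne, h2]
  push_cast at *
  set s := Complex.sin (θ / 2)
  set c := Complex.cos (θ / 2)
  have hI := Complex.I_sq
  have e1 : 1 + (c + s * Complex.I) ^ 2 = 2 * c * (c + s * Complex.I) := by
    linear_combination s ^ 2 * hI - h3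
  have e2 : 1 - (c + s * Complex.I) ^ 2 = -(2 * s * Complex.I * (c + s * Complex.I)) := by
    linear_combination s ^ 2 * hI - h3
  rw [e1, e2]
  field_simp

theorem exists_cayleyBoundary_eq (x : ℝ) : ∃ θ ∈ Ioo 0 (2 * π), cayleyBoundary θ = x := by
  have h1 := Real.arctan_lt_pi_div_two x
  have h2 := Real.neg_pi_div_two_lt_arctan x
  refine ⟨π + 2 * arctan x, ⟨by linarith, by linarith⟩, ?_⟩
  rw [cayleyBoundary, show (π + 2 * arctan x) / 2 = arctan x + π / 2 by ring,
    Real.cos_add_pi_div_two, Real.sin_add_pi_div_two, neg_div, neg_neg, ← Real.tan_eq_sin_div_cos,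
    Real.tan_arctan]

theorem differentiableOn_cayleyBoundary : DifferentiableOn ℝ cayleyBoundary (Ioo 0 (2 * π)) := by
  intro θ hθ
  unfold cayleyBoundary
  have h1 : DifferentiableAt ℝ (fun θ : ℝ => cos (θ / 2)) θ := by fun_prop
  have h2 : DifferentiableAt ℝ (fun θ : ℝ => sin (θ / 2)) θ := by fun_prop
  exact (h1.div h2 (sin_half_pos hθ).ne').neg.differentiableWithinAt

/-- A bounded non-vanishing holomorphic function on the upper half-plane which is continuous up to
the real line has a null set of real zeros. -/
theorem volume_real_zeros_eq_zero {D : ℂ → ℂ} {C : ℝ}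
    (hd : ∀ z : ℂ, 0 < z.im → DifferentiableAt ℂ D z) (hc : ContinuousOn D {z | 0 ≤ z.im})
    (hb : ∀ z : ℂ, 0 < z.im → ‖D z‖ ≤ C) (hne : ∀ z : ℂ, 0 < z.im → D z ≠ 0) :
    volume {x : ℝ | D x = 0} = 0 := by
  set g : ℂ → ℂ := fun w => D (cayley w) with hg
  have hgd : ∀ w ∈ Metric.ball (0 : ℂ) 1, DifferentiableAt ℂ g w := fun w hw => by
    rw [mem_ball_zero_iff] at hw
    refine DifferentiableAt.comp w (hd _ (cayley_im_pos hw)) (differentiableAt_cayley ?_)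
    rintro rfl
    simp at hw
  have hgne : ∀ w ∈ Metric.ball (0 : ℂ) 1, g w ≠ 0 := fun w hw =>
    hne _ (cayley_im_pos (mem_ball_zero_iff.1 hw))
  have hgb : ∀ w ∈ Metric.ball (0 : ℂ) 1, ‖g w‖ ≤ C := fun w hw =>
    hb _ (cayley_im_pos (mem_ball_zero_iff.1 hw))
  have hga : AnalyticOnNhd ℂ g (Metric.ball 0 1) :=
    DifferentiableOn.analyticOnNhd (fun w hw => (hgd w hw).differentiableWithinAt)
      Metric.isOpen_ball
  set r : ℕ → ℝ := fun k => 1 - 1 / ((k : ℝ) + 2) with hr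
  have hr0 : ∀ k, 0 ≤ r k := fun k => by
    have hk : (0 : ℝ) ≤ k := k.cast_nonneg
    rw [hr, sub_nonneg, div_le_one (by linarith)]; linarith
  have hr1 : ∀ k, r k < 1 := fun k => by
    have : (0 : ℝ) < 1 / ((k : ℝ) + 2) := by positivity
    simp only [hr]; linarith
  have hrlim : Tendsto r atTop (𝓝 1) := by
    have h1 : Tendsto (fun k : ℕ => 1 / ((k : ℝ) + 2)) atTop (𝓝 0) := by
      simp only [one_div]
      exact tendsto_inv_atTop_zero.comp
        (tendsto_atTop_add_const_right _ _ tendsto_natCast_atTop_atTop)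
    simpa only [sub_zero] using h1.const_sub 1
  have hmem : ∀ k θ, circleMap 0 (r k) θ ∈ Metric.ball (0 : ℂ) 1 := fun k θ => by
    rw [mem_ball_zero_iff, norm_circleMap_zero, abs_of_nonneg (hr0 k)]; exact hr1 k
  have hcont : ∀ k, Continuous fun θ : ℝ => log C - log ‖g (circleMap 0 (r k) θ)‖ := fun k => by
    refine continuous_const.sub (Continuous.log ?_ fun θ => norm_ne_zero_iff.2 (hgne _ (hmem k θ)))
    refine Continuous.norm (continuous_iff_continuousAt.2 fun θ => ?_)
    exact ContinuousAt.comp (f := circleMap 0 (r k)) (hgd _ (hmem k θ)).continuousAt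
      (continuous_circleMap 0 (r k)).continuousAt
  have hnn : ∀ k θ, 0 ≤ log C - log ‖g (circleMap 0 (r k) θ)‖ := fun k θ =>
    sub_nonneg.2 (log_le_log (norm_pos_iff.2 (hgne _ (hmem k θ))) (hgb _ (hmem k θ)))
  have havg : ∀ k, ∫ θ in (0 : ℝ)..(2 * π), (log C - log ‖g (circleMap 0 (r k) θ)‖) =
      2 * π * (log C - log ‖g 0‖) := fun k => by
    have hsub : Metric.closedBall (0 : ℂ) |r k| ⊆ Metric.ball 0 1 :=
      Metric.closedBall_subset_ball (by rw [abs_of_nonneg (hr0 k)]; exact hr1 k)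
    have h1 := AnalyticOnNhd.circleAverage_log_norm_of_ne_zero (hga.mono hsub)
      (fun u hu => hgne u (hsub hu))
    rw [circleAverage_def, smul_eq_mul, inv_mul_eq_iff_eq_mul₀ (by positivity)] at h1
    rw [intervalIntegral.integral_sub (by simp), h1]
    · simp; ring
    · have h2 : Continuous fun θ : ℝ => log C - (log C - log ‖g (circleMap 0 (r k) θ)‖) :=
        continuous_const.sub (hcont k)
      simp only [sub_sub_cancel] at h2
      exact h2.intervalIntegrable _ _
  have hlint : ∀ k, ∫⁻ θ in Ioc 0 (2 * π),
      ENNReal.ofReal (log C - log ‖g (circleMap 0 (r k) θ)‖) =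
      ENNReal.ofReal (2 * π * (log C - log ‖g 0‖)) := fun k => by
    rw [← havg k, intervalIntegral.integral_of_le (by positivity),
      ofReal_integral_eq_lintegral_ofReal ((hcont k).integrableOn_Ioc)
        (Eventually.of_forall fun θ => hnn k θ)]
  have hmeas : ∀ k, Measurable fun θ : ℝ =>
      ENNReal.ofReal (log C - log ‖g (circleMap 0 (r k) θ)‖) := fun k =>
    ENNReal.measurable_ofReal.comp (hcont k).measurable
  have hfatou : ∫⁻ θ in Ioc 0 (2 * π),
      liminf (fun k => ENNReal.ofReal (log C - log ‖g (circleMap 0 (r k) θ)‖)) atTop < ∞ := by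
    refine (lintegral_liminf_le hmeas).trans_lt ?_
    simp_rw [hlint]
    rw [liminf_const]
    exact ENNReal.ofReal_lt_top
  have hae := ae_lt_top (Measurable.liminf hmeas) hfatou.ne
  rw [ae_restrict_iff' measurableSet_Ioc] at hae
  set N := {θ : ℝ | θ ∈ Ioo 0 (2 * π) ∧ D (cayleyBoundary θ) = 0} with hN
  have hN0 : volume N = 0 := by
    refine measure_mono_null (fun θ hθ => ?_) (ae_iff.1 hae)
    obtain ⟨hθ, hD⟩ := hθ
    simp only [mem_ofPred_eq, Classical.not_imp, not_lt, top_le_iff]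
    refine ⟨Ioo_subset_Ioc_self hθ, ?_⟩
    refine Tendsto.liminf_eq (ENNReal.tendsto_ofReal_nhds_top.2 ?_)
    have h1 : Tendsto (fun k => circleMap 0 (r k) θ) atTop (𝓝 (Complex.exp (θ * Complex.I))) := by
      simp only [circleMap, zero_add]
      have := (Complex.continuous_ofReal.tendsto 1).comp hrlim
      simpa using this.mul_const (Complex.exp (θ * Complex.I))
    have h2 : Tendsto (fun k => cayley (circleMap 0 (r k) θ)) atTop
        (𝓝[{z | 0 ≤ z.im}] (cayleyBoundary θ : ℂ)) := by
      refine tendsto_nhdsWithin_iff.2 ⟨?_, Eventually.of_forall fun k =>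
        (cayley_im_pos (mem_ball_zero_iff.1 (hmem k θ))).le⟩
      rw [← cayley_exp hθ]
      exact (differentiableAt_cayley (exp_ne_one hθ)).continuousAt.tendsto.comp h1
    have h3 : Tendsto (fun k => g (circleMap 0 (r k) θ)) atTop (𝓝 0) := by
      have h4 := (hc (cayleyBoundary θ : ℂ) (by simp)).tendsto
      rw [hD] at h4
      exact h4.comp h2
    have h5 : Tendsto (fun k => ‖g (circleMap 0 (r k) θ)‖) atTop (𝓝[≠] 0) := by
      refine tendsto_nhdsWithin_iff.2 ⟨by simpa using h3.norm, Eventually.of_forall fun k => ?_⟩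
      exact norm_ne_zero_iff.2 (hgne _ (hmem k θ))
    have h6 := tendsto_neg_atBot_atTop.comp (Real.tendsto_log_nhdsNE_zero.comp h5)
    simpa only [sub_eq_add_neg, Function.comp_def] using tendsto_atTop_add_const_left _ (log C) h6
  have himg := addHaar_image_eq_zero_of_differentiableOn_of_addHaar_eq_zero volume
    (differentiableOn_cayleyBoundary.mono fun θ (hθ : θ ∈ N) => hθ.1) hN0
  refine measure_mono_null (fun x hx => ?_) himg
  obtain ⟨θ, hθ, rfl⟩ := exists_cayleyBoundary_eq x
  exact ⟨θ, ⟨hθ, hx⟩, rfl⟩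

end BoundaryUniqueness

section Determinant

variable {d : ℕ}

/-- The coordinate functional `T ↦ (T e_j)(i)` on operators. -/
def matrixEntry (i j : Lattice d) : (L2 d →L[ℂ] L2 d) →L[ℂ] ℂ :=
  LinearMap.mkContinuous
    { toFun := fun T => T (lp.single 2 j (1 : ℂ)) i
      map_add' := fun _ _ => rfl
      map_smul' := fun _ _ => rfl } 1 fun T => by
    refine (lp.norm_apply_le_norm (by norm_num) _ i).trans ?_
    refine (T.le_opNorm _).trans ?_
    rw [lp.norm_single (by norm_num), norm_one, mul_one, one_mul]

theorem matrixEntry_apply (i j : Lattice d) (T : L2 d →L[ℂ] L2 d) :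
    matrixEntry i j T = T (lp.single 2 j (1 : ℂ)) i := rfl

theorem norm_matrixEntry_le (i j : Lattice d) (T : L2 d →L[ℂ] L2 d) :
    ‖matrixEntry i j T‖ ≤ ‖T‖ := by
  have h := (matrixEntry i j).le_opNorm T
  have h1 : ‖matrixEntry (d := d) i j‖ ≤ 1 := LinearMap.mkContinuous_norm_le _ zero_le_one _
  nlinarith [norm_nonneg T]

/-- The finite matrix whose determinant detects whether `1 + T` is singular. -/
def reducedMatrix (S : Finset (Lattice d)) (T : L2 d →L[ℂ] L2 d) : Matrix S S ℂ :=
  Matrix.of fun i j => (1 : Matrix S S ℂ) i j +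
    matrixEntry (i : Lattice d) (j : Lattice d) (T * Ring.inverse (1 + cutoff S * T))

theorem isUnit_one_add_of_norm_le {T : L2 d →L[ℂ] L2 d} (hT : ‖T‖ ≤ 1 / 2) : IsUnit (1 + T) := by
  have := isUnit_one_sub_of_norm_lt_one (x := -T) (by rw [norm_neg]; linarith)
  rwa [sub_neg_eq_add] at this

theorem norm_inverse_one_add_le {T : L2 d →L[ℂ] L2 d} (hT : ‖T‖ ≤ 1 / 2) :
    ‖Ring.inverse (1 + T)‖ ≤ 2 := by
  set R := Ring.inverse (1 + T) with hR
  have h1 : (1 + T) * R = 1 := Ring.mul_inverse_cancel _ (isUnit_one_add_of_norm_le hT)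
  have h2 : R = 1 - T * R := by rw [← h1]; noncomm_ring
  have h3 : ‖R‖ ≤ 1 + 1 / 2 * ‖R‖ := by
    calc ‖R‖ = ‖1 - T * R‖ := by rw [← h2]
      _ ≤ ‖(1 : L2 d →L[ℂ] L2 d)‖ + ‖T * R‖ := norm_sub_le _ _
      _ ≤ 1 + 1 / 2 * ‖R‖ := by
          gcongr
          · exact ContinuousLinearMap.norm_id_le
          · exact (norm_mul_le _ _).trans (by gcongr)
  linarith

theorem sum_single_apply (S : Finset (Lattice d)) (v : S → ℂ) (n : Lattice d) :
    (∑ j, v j • (lp.single 2 (j : Lattice d) (1 : ℂ) : L2 d) : L2 d) n =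
      if h : n ∈ S then v ⟨n, h⟩ else 0 := by
  rw [lp.coeFn_sum, Finset.sum_apply]
  simp only [lp.coeFn_smul, Pi.smul_apply, smul_eq_mul]
  split_ifs with h
  · rw [Finset.sum_eq_single ⟨n, h⟩]
    · rw [lp.single_apply_self, mul_one]
    · intro j _ hj
      rw [lp.single_apply_ne _ _ _ (fun h' => hj (Subtype.ext h'.symm)), mul_zero]
    · simp
  · refine Finset.sum_eq_zero fun j _ => ?_
    rw [lp.single_apply_ne _ _ _ (fun h' : n = j => h (by rw [h']; exact j.2)), mul_zero]

theorem reducedMatrix_mulVec (S : Finset (Lattice d)) (T : L2 d →L[ℂ] L2 d) (v : S → ℂ) (i : S) :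
    (reducedMatrix S T).mulVec v i = v i +
      (T * Ring.inverse (1 + cutoff S * T))
        (∑ j, v j • (lp.single 2 (j : Lattice d) (1 : ℂ) : L2 d)) i := by
  have h1 : reducedMatrix S T = 1 + Matrix.of fun i j : S =>
    matrixEntry (i : Lattice d) (j : Lattice d) (T * Ring.inverse (1 + cutoff S * T)) := rfl
  rw [h1, Matrix.add_mulVec, Matrix.one_mulVec, Pi.add_apply, map_sum, lp.coeFn_sum,
    Finset.sum_apply]
  congr 1
  simp only [Matrix.mulVec, dotProduct, Matrix.of_apply, matrixEntry_apply, map_smul,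
    lp.coeFn_smul, Pi.smul_apply, smul_eq_mul]
  exact Finset.sum_congr rfl fun j _ => mul_comm _ _

/-- The operator `1 + T` has a non-trivial kernel iff the reduced determinant vanishes. -/
theorem det_reducedMatrix_eq_zero_iff (S : Finset (Lattice d)) (T : L2 d →L[ℂ] L2 d)
    (hT : ‖cutoff S * T‖ ≤ 1 / 2) :
    (reducedMatrix S T).det = 0 ↔ ∃ f : L2 d, f ≠ 0 ∧ f = -(T f) := by
  have hu := isUnit_one_add_of_norm_le hT
  set A := 1 + cutoff S * T with hA
  set R := Ring.inverse A with hR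
  have hAR : ∀ g, A (R g) = g := fun g => by
    rw [← mul_apply_eq_comp, Ring.mul_inverse_cancel _ hu, one_apply_eq_self]
  have hRA : ∀ g, R (A g) = g := fun g => by
    rw [← mul_apply_eq_comp, Ring.inverse_mul_cancel _ hu, one_apply_eq_self]
  have hAf : ∀ (f : L2 d) (n : Lattice d), A f n = f n + if n ∈ S then 0 else T f n := fun f n => by
    rw [hA, add_apply, one_apply_eq_self, mul_apply_eq_comp, lp.coeFn_add, Pi.add_apply,
      cutoff_apply]
  rw [← Matrix.exists_mulVec_eq_zero_iff]
  constructor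
  · rintro ⟨v, hv0, hv⟩
    set g : L2 d := ∑ j, v j • (lp.single 2 (j : Lattice d) (1 : ℂ) : L2 d) with hg
    have hg0 : g ≠ 0 := fun h => hv0 <| by
      funext i
      have := sum_single_apply S v i
      rw [← hg, h, dif_pos i.2] at this
      simpa using this.symm
    refine ⟨R g, fun h => hg0 (by rw [← hAR g, h, map_zero]), ?_⟩
    apply lp.ext
    funext n
    rw [lp.coeFn_neg, Pi.neg_apply, ← add_eq_zero_iff_eq_neg]
    have h1 := hAf (R g) n
    rw [hAR, hg, sum_single_apply] at h1
    by_cases hn : n ∈ S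
    · rw [dif_pos hn, if_pos hn, add_zero] at h1
      have h2 := congrFun hv ⟨n, hn⟩
      rw [reducedMatrix_mulVec] at h2
      rw [← h1]
      exact h2
    · rw [dif_neg hn, if_neg hn] at h1
      exact h1.symm
  · rintro ⟨f, hf0, hf⟩
    have hfn : ∀ n, f n + T f n = 0 := fun n => by
      have h1 : f n = -(T f n) := by
        conv_lhs => rw [hf]
        rfl
      rw [h1]; ring
    have hg : ∑ j : S, f j • (lp.single 2 (j : Lattice d) (1 : ℂ) : L2 d) = A f := by
      apply lp.ext
      funext n
      rw [sum_single_apply S (fun j => f j), hAf]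
      by_cases hn : n ∈ S
      · rw [dif_pos hn, if_pos hn, add_zero]
      · rw [dif_neg hn, if_neg hn, hfn]
    refine ⟨fun j => f j, fun h => hf0 ?_, ?_⟩
    · rw [← hRA f, ← hg, Finset.sum_eq_zero, map_zero]
      intro j _
      have : f j = 0 := congrFun h j
      rw [this, zero_smul]
    · funext i
      rw [reducedMatrix_mulVec, hg, mul_apply_eq_comp, hRA]
      exact hfn i

theorem norm_det_reducedMatrix_le (S : Finset (Lattice d)) {T : L2 d →L[ℂ] L2 d} {C : ℝ}
    (hC : ‖T‖ ≤ C) (hT : ‖cutoff S * T‖ ≤ 1 / 2) :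
    ‖(reducedMatrix S T).det‖ ≤ (Fintype.card S).factorial • (1 + C * 2) ^ Fintype.card S := by
  refine Matrix.det_le (abv := NormedField.toAbsoluteValue ℂ) fun i j => ?_
  have h1 : ‖(1 : Matrix S S ℂ) i j‖ ≤ 1 := by
    rw [Matrix.one_apply]; split_ifs <;> simp
  refine (norm_add_le _ _).trans (add_le_add h1 ((norm_matrixEntry_le _ _ _).trans
    ((norm_mul_le _ _).trans ?_)))
  exact mul_le_mul hC (norm_inverse_one_add_le hT) (norm_nonneg _) ((norm_nonneg _).trans hC)

theorem continuousWithinAt_det_reducedMatrix (S : Finset (Lattice d)) {Y : ℂ → L2 d →L[ℂ] L2 d}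
    {U : Set ℂ} {z : ℂ} (hY : ContinuousWithinAt Y U z) (hz : ‖cutoff S * Y z‖ ≤ 1 / 2) :
    ContinuousWithinAt (fun z => (reducedMatrix S (Y z)).det) U z := by
  have h1 : ContinuousWithinAt (fun z => 1 + cutoff S * Y z) U z :=
    continuousWithinAt_const.add (continuousWithinAt_const.mul hY)
  have h2 : ContinuousAt Ring.inverse (1 + cutoff S * Y z) :=
    (differentiableAt_inverse (𝕜 := ℂ) (isUnit_one_add_of_norm_le hz)).continuousAt
  have h3 : ContinuousWithinAt (fun z => Y z * Ring.inverse (1 + cutoff S * Y z)) U z :=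
    hY.mul (ContinuousAt.comp_continuousWithinAt (f := fun z => 1 + cutoff S * Y z) h2 h1)
  have h4 : ContinuousWithinAt (fun z => reducedMatrix S (Y z)) U z := by
    refine continuousWithinAt_pi.2 fun i => continuousWithinAt_pi.2 fun j => ?_
    exact continuousWithinAt_const.add
      ((matrixEntry (i : Lattice d)
        (j : Lattice d)).continuous.continuousAt.comp_continuousWithinAt h3)
  exact (continuous_id.matrix_det).continuousAt.comp_continuousWithinAt h4

theorem differentiableAt_det_reducedMatrix (S : Finset (Lattice d)) {Y : ℂ → L2 d →L[ℂ] L2 d}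
    {z : ℂ} (hY : DifferentiableAt ℂ Y z) (hz : ‖cutoff S * Y z‖ ≤ 1 / 2) :
    DifferentiableAt ℂ (fun z => (reducedMatrix S (Y z)).det) z := by
  have h1 : DifferentiableAt ℂ (fun z => 1 + cutoff S * Y z) z :=
    (differentiableAt_const _).add (hY.const_mul (cutoff S))
  have h2 : DifferentiableAt ℂ Ring.inverse (1 + cutoff S * Y z) :=
    differentiableAt_inverse (𝕜 := ℂ) (isUnit_one_add_of_norm_le hz)
  have h3 : DifferentiableAt ℂ (fun z => Y z * Ring.inverse (1 + cutoff S * Y z)) z :=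
    hY.mul (DifferentiableAt.comp (f := fun z => 1 + cutoff S * Y z) z h2 h1)
  have h4 : ∀ i j, DifferentiableAt ℂ (fun z => reducedMatrix S (Y z) i j) z := fun i j =>
    (differentiableAt_const _).add
      ((matrixEntry (i : Lattice d) (j : Lattice d)).differentiableAt.comp z h3)
  simp only [Matrix.det_apply]
  refine DifferentiableAt.fun_sum fun σ _ => DifferentiableAt.const_smul ?_ _
  exact DifferentiableAt.fun_finsetProd fun i _ => h4 _ _

end Determinant

section BirmanSchwinger

variable {d : ℕ} {V : Lattice d → ℝ} {q₂ : Lattice d → ℂ}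

/-- The resolvent `(H - z)⁻¹` of the Schrödinger operator. -/
def fullResolvent (V : Lattice d → ℝ) (z : ℂ) : L2 d →L[ℂ] L2 d :=
  Ring.inverse (hamiltonian V - algebraMap ℂ (L2 d →L[ℂ] L2 d) z)

theorem mulOp_mul_mulOp_sqrtAbs (h1 : Memℓp (sqrtAbs V) ∞) (h2 : Memℓp q₂ ∞)
    (hV : Memℓp (fun n => (V n : ℂ)) ∞) (hVq : ∀ n, (V n : ℂ) = sqrtAbs V n * q₂ n) :
    mulOp q₂ * mulOp (sqrtAbs V) = mulOp fun n => (V n : ℂ) := by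
  ext f n
  rw [mul_apply_eq_comp, mulOp_apply h2, mulOp_apply h1, mulOp_apply hV, hVq]
  ring

/-- The Birman–Schwinger resolvent identity. -/
theorem birmanSchwinger_identity (h1 : Memℓp (sqrtAbs V) ∞) (h2 : Memℓp q₂ ∞)
    (hV : Memℓp (fun n => (V n : ℂ)) ∞) (hVq : ∀ n, (V n : ℂ) = sqrtAbs V n * q₂ n) {z : ℂ}
    (hz : 0 < z.im) :
    (1 - mulOp (sqrtAbs V) * fullResolvent V z * mulOp q₂) * (1 + sandwichedResolvent V q₂ z) =
      1 := by
  have hH : IsSelfAdjoint (hamiltonian V) :=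
    (isSelfAdjoint_discreteLaplacian d).add (isSelfAdjoint_mulOp hV)
  have ha : (discreteLaplacian d - algebraMap ℂ (L2 d →L[ℂ] L2 d) z) * freeResolvent d z = 1 :=
    Ring.mul_inverse_cancel _ (isUnit_sub_algebraMap
      (notMem_spectrum_of_im_pos (isSelfAdjoint_discreteLaplacian d) hz))
  have hh : fullResolvent V z * (hamiltonian V - algebraMap ℂ (L2 d →L[ℂ] L2 d) z) = 1 :=
    Ring.inverse_mul_cancel _ (isUnit_sub_algebraMap (notMem_spectrum_of_im_pos hH hz))
  have hqq := mulOp_mul_mulOp_sqrtAbs h1 h2 hV hVq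
  have hY : sandwichedResolvent V q₂ z = mulOp (sqrtAbs V) * freeResolvent d z * mulOp q₂ := rfl
  have hV' : mulOp (fun n => (V n : ℂ)) = (hamiltonian V - algebraMap ℂ (L2 d →L[ℂ] L2 d) z) -
      (discreteLaplacian d - algebraMap ℂ (L2 d →L[ℂ] L2 d) z) := by
    rw [hamiltonian]; abel
  rw [hV'] at hqq
  set R := fullResolvent V z
  set R₀ := freeResolvent d z
  set h := hamiltonian V - algebraMap ℂ (L2 d →L[ℂ] L2 d) z
  set a := discreteLaplacian d - algebraMap ℂ (L2 d →L[ℂ] L2 d) z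
  have hres : R * (mulOp q₂ * mulOp (sqrtAbs V)) * R₀ = R₀ - R := by
    rw [hqq, mul_sub, sub_mul, hh, one_mul, mul_assoc, ha, mul_one]
  rw [hY]
  have hexp : mulOp (sqrtAbs V) * R * mulOp q₂ * (mulOp (sqrtAbs V) * R₀ * mulOp q₂) =
      mulOp (sqrtAbs V) * (R * (mulOp q₂ * mulOp (sqrtAbs V)) * R₀) * mulOp q₂ := by
    simp only [mul_assoc]
  rw [sub_mul, one_mul, mul_add, mul_one, hexp, hres]
  noncomm_ring

theorem birmanSchwingerSpectrum_subset (hd : 3 ≤ d) (h1 : Memℓp (sqrtAbs V) ∞) (h2 : Memℓp q₂ ∞)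
    (hV : Memℓp (fun n => (V n : ℂ)) ∞) (hVq : ∀ n, (V n : ℂ) = sqrtAbs V n * q₂ n)
    (hG : Summable (hsMajorant V q₂)) {x : ℝ} (hx : x ∈ birmanSchwingerSpectrum V q₂) :
    (x : ℂ) ∈ spectrum ℂ (hamiltonian V) := by
  by_contra hns
  obtain ⟨f, hf0, hf⟩ := hx
  have hne := nhdsWithin_upperHalf_neBot (x := (x : ℂ)) (by simp)
  have hY := tendsto_extendedResolvent hd h1 h2 hG (x := (x : ℂ)) (by simp)
  have hR : Tendsto (fullResolvent V) (𝓝[{z : ℂ | 0 < z.im}] (x : ℂ)) (𝓝 (fullResolvent V x)) :=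
    (differentiableAt_ringInverse_sub hns).continuousAt.tendsto.mono_left nhdsWithin_le_nhds
  have hlim := (((hR.const_mul (mulOp (sqrtAbs V))).mul_const (mulOp q₂)).const_sub 1).mul
    (hY.const_add 1)
  have hlim1 : Tendsto (fun z => (1 - mulOp (sqrtAbs V) * fullResolvent V z * mulOp q₂) *
      (1 + sandwichedResolvent V q₂ z)) (𝓝[{z : ℂ | 0 < z.im}] (x : ℂ)) (𝓝 1) :=
    tendsto_const_nhds.congr' (by
      filter_upwards [self_mem_nhdsWithin] with z hz
      exact (birmanSchwinger_identity h1 h2 hV hVq hz).symm)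
  have heq := tendsto_nhds_unique hlim hlim1
  have hz : (1 + extendedResolvent V q₂ (x : ℂ)) f = 0 := by
    rw [add_apply, one_apply_eq_self, add_eq_zero_iff_eq_neg, ← boundaryResolvent_eq]
    exact hf
  apply hf0
  rw [← one_apply_eq_self (F := L2 d →L[ℂ] L2 d) f, ← heq, mul_apply_eq_comp, hz, map_zero]

theorem eq_zero_of_eq_neg_sandwichedResolvent (h1 : Memℓp (sqrtAbs V) ∞) (h2 : Memℓp q₂ ∞)
    (hV : Memℓp (fun n => (V n : ℂ)) ∞) (hVq : ∀ n, (V n : ℂ) = sqrtAbs V n * q₂ n) {z : ℂ}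
    (hz : 0 < z.im) {f : L2 d} (hf : f = -(sandwichedResolvent V q₂ z f)) : f = 0 := by
  have h := birmanSchwinger_identity h1 h2 hV hVq hz
  have h3 : (1 + sandwichedResolvent V q₂ z) f = 0 := by
    rw [add_apply, one_apply_eq_self, add_eq_zero_iff_eq_neg]
    exact hf
  rw [← one_apply_eq_self (F := L2 d →L[ℂ] L2 d) f, ← h, mul_apply_eq_comp, h3, map_zero]

theorem isClosed_and_null_birmanSchwingerSpectrum (hd : 3 ≤ d) (h1 : Memℓp (sqrtAbs V) ∞)
    (h2 : Memℓp q₂ ∞) (hV : Memℓp (fun n => (V n : ℂ)) ∞)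
    (hVq : ∀ n, (V n : ℂ) = sqrtAbs V n * q₂ n) (hG : Summable (hsMajorant V q₂)) :
    IsClosed (birmanSchwingerSpectrum V q₂) ∧ volume (birmanSchwingerSpectrum V q₂) = 0 := by
  obtain ⟨S, hS⟩ := exists_norm_cutoff_mul_le hd h1 h2 hG
  obtain ⟨C, hC⟩ := exists_norm_extendedResolvent_le hd h1 h2 hG
  set D : ℂ → ℂ := fun z => (reducedMatrix S (extendedResolvent V q₂ z)).det with hD
  have hBS : birmanSchwingerSpectrum V q₂ = {x : ℝ | D x = 0} := by
    ext x
    exact (det_reducedMatrix_eq_zero_iff S _ (hS x (by simp))).symm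
  have hcont : ContinuousOn D {z | 0 ≤ z.im} := fun z hz =>
    continuousWithinAt_det_reducedMatrix S (continuousOn_extendedResolvent hd h1 h2 hG z hz)
      (hS z hz)
  rw [hBS]
  constructor
  · have : Continuous fun x : ℝ => D x :=
      hcont.comp_continuous Complex.continuous_ofReal (fun x => by simp)
    exact isClosed_eq this continuous_const
  · refine volume_real_zeros_eq_zero
      (C := (Fintype.card S).factorial • (1 + C * 2) ^ Fintype.card S) (fun z hz => ?_) hcont
      (fun z hz => norm_det_reducedMatrix_le S (hC z hz.le) (hS z hz.le)) (fun z hz h => ?_)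
    · refine differentiableAt_det_reducedMatrix S ?_ (hS z hz.le)
      refine (differentiableAt_sandwichedResolvent (V := V) (q₂ := q₂) hz).congr_of_eventuallyEq ?_
      filter_upwards [(isOpen_lt continuous_const Complex.continuous_im).mem_nhds hz] with w hw
      exact extendedResolvent_eq hw
    · obtain ⟨f, hf0, hf⟩ := (det_reducedMatrix_eq_zero_iff S _ (hS z hz.le)).1 h
      rw [extendedResolvent_eq hz] at hf
      exact hf0 (eq_zero_of_eq_neg_sandwichedResolvent h1 h2 hV hVq hz hf)

theorem isCompact_birmanSchwingerSpectrum (hcl : IsClosed (birmanSchwingerSpectrum V q₂))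
    (hsub : ∀ x ∈ birmanSchwingerSpectrum V q₂, (x : ℂ) ∈ spectrum ℂ (hamiltonian V)) :
    IsCompact (birmanSchwingerSpectrum V q₂) := by
  refine Metric.isCompact_of_isClosed_isBounded hcl ?_
  obtain ⟨C, hC⟩ := (spectrum.isBounded (𝕜 := ℂ) (hamiltonian V)).exists_norm_le
  refine isBounded_iff_forall_norm_le.2 ⟨C, fun x hx => ?_⟩
  simpa using hC _ (hsub x hx)

end BirmanSchwinger

section Exponents

variable {d : ℕ}

theorem exists_exponent (hd : 3 ≤ d) {p : ℝ} (hp1 : 1 ≤ p) (hp3 : d = 3 → p < 6 / 5)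
    (hp4 : 4 ≤ d → p < 3 * (d : ℝ) / (2 * (d : ℝ) + 1)) :
    ∃ p' : ℝ, p ≤ p' ∧ 1 < p' ∧ p' < 2 * (d : ℝ) / (d + 2) := by
  have hd3 : (3 : ℝ) ≤ d := by exact_mod_cast hd
  have hp : p < 2 * (d : ℝ) / (d + 2) := by
    rcases hd.eq_or_lt with h | h
    · have := hp3 h.symm
      rw [← h]; norm_num; exact this
    · have hd4 : (4 : ℝ) ≤ d := by exact_mod_cast h
      refine (hp4 h).trans_le ?_
      rw [div_le_div_iff₀ (by linarith) (by linarith)]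
      nlinarith
  obtain ⟨p', h1, h2⟩ := exists_between hp
  exact ⟨p', h1.le, hp1.trans_lt h1, h2⟩

theorem summable_norm_rpow_of_memlp {E : Type*} [NormedAddCommGroup E] {u : Lattice d → E}
    {p p' : ℝ} (hp : 0 < p) (hpp : p ≤ p') (hu : Memℓp u (ENNReal.ofReal p)) :
    Summable fun n => ‖u n‖ ^ p' := by
  have h1 := hu.of_exponent_ge (ENNReal.ofReal_le_ofReal hpp)
  have h2 : (ENNReal.ofReal p').toReal = p' := ENNReal.toReal_ofReal (hp.le.trans hpp)
  have h3 := h1.summable (by rw [h2]; linarith)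
  rwa [h2] at h3

theorem memlp_infty_ofReal {V : Lattice d → ℝ} (hV : Memℓp V ∞) :
    Memℓp (fun n => (V n : ℂ)) ∞ := by
  obtain ⟨C, hC⟩ := memℓp_infty_iff.1 hV
  refine memℓp_infty ⟨C, ?_⟩
  rintro _ ⟨n, rfl⟩
  simpa using hC ⟨n, rfl⟩

theorem memlp_infty_sqrtAbs {V : Lattice d → ℝ} (hV : Memℓp V ∞) : Memℓp (sqrtAbs V) ∞ := by
  obtain ⟨C, hC⟩ := memℓp_infty_iff.1 hV
  refine memℓp_infty ⟨√C, ?_⟩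
  rintro _ ⟨n, rfl⟩
  have h : |V n| ≤ C := hC ⟨n, rfl⟩
  simp only [sqrtAbs, Complex.norm_real, Real.norm_of_nonneg (Real.sqrt_nonneg _)]
  exact Real.sqrt_le_sqrt h

end Exponents

end LatticeSchrodinger

end

theorem proposition4p6 (d : ℕ) (hd : 3 ≤ d) (p : ℝ) (hp1 : 1 ≤ p)
    (hp3 : d = 3 → p < 6 / 5) (hp4 : 4 ≤ d → p < 3 * (d : ℝ) / (2 * (d : ℝ) + 1))
    (V : LatticeSchrodinger.Lattice d → ℝ) (hV : Memℓp V (ENNReal.ofReal p))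
    (q₂ : LatticeSchrodinger.Lattice d → ℂ) (hq₂ : Memℓp q₂ (ENNReal.ofReal (2 * p)))
    (hVq : ∀ n, (V n : ℂ) = LatticeSchrodinger.sqrtAbs V n * q₂ n) :
    (∀ x : ℝ, Tendsto (LatticeSchrodinger.sandwichedResolvent V q₂)
        (𝓝[{z : ℂ | 0 < z.im}] (x : ℂ))
        (𝓝 (LatticeSchrodinger.boundaryResolvent V q₂ x))) ∧
      IsCompact (LatticeSchrodinger.birmanSchwingerSpectrum V q₂) ∧
      (∀ x ∈ LatticeSchrodinger.birmanSchwingerSpectrum V q₂,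
        (x : ℂ) ∈ spectrum ℂ (LatticeSchrodinger.hamiltonian V)) ∧
      volume (LatticeSchrodinger.birmanSchwingerSpectrum V q₂) = 0 := by
  obtain ⟨p', hpp, hp1', hpd⟩ := LatticeSchrodinger.exists_exponent hd hp1 hp3 hp4
  have hVs := LatticeSchrodinger.summable_norm_rpow_of_memlp (by linarith) hpp hV
  have hqs := LatticeSchrodinger.summable_norm_rpow_of_memlp (p' := 2 * p') (by linarith)
    (by linarith) hq₂
  have hG := LatticeSchrodinger.summable_hsMajorant hd hp1' hpd hVs hqs
  have hV' : Memℓp V ∞ := hV.of_exponent_ge le_top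
  have h1 := LatticeSchrodinger.memlp_infty_sqrtAbs hV'
  have h2 : Memℓp q₂ ∞ := hq₂.of_exponent_ge le_top
  have h3 := LatticeSchrodinger.memlp_infty_ofReal hV'
  have hsub := fun x hx =>
    LatticeSchrodinger.birmanSchwingerSpectrum_subset hd h1 h2 h3 hVq hG (x := x) hx
  obtain ⟨hcl, hnull⟩ :=
    LatticeSchrodinger.isClosed_and_null_birmanSchwingerSpectrum hd h1 h2 h3 hVq hG
  exact ⟨fun x => LatticeSchrodinger.tendsto_extendedResolvent hd h1 h2 hG (by simp),
    LatticeSchrodinger.isCompact_birmanSchwingerSpectrum hcl hsub, hsub, hnull⟩
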